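/- Let $(\mathbb{C}^*)^2$ carry its usual topology and let $$H=\{(z_1,z_2)\in(\mathbb{C}^*)^2 : 1+z_1+z_2=0\}.$$ Let $K$ be the field of real-power Puiseux series $\sum_{j\in I}c_jt^j$ with $c_j\in\mathbb{C}$ and $I\subset\mathbb{R}$ well ordered, let $K^*=K\setminus\{0\}$, and let $\mathrm{val}:K^*\to\mathbb{C}^*$ be the complexified valuation, which sends a series with lowest-order term $c\,t^{j_0}$ ($c\neq 0$) to $e^{-j_0+i\arg(c)}$. Write $\mathrm{val}_2:(K^*)^2\to(\mathbb{C}^*)^2$ for the map that applies $\mathrm{val}$ to each coordinate. The phase tropical line is $$H_{trop}=\overline{\mathrm{val}_2\big(\{(z_1,z_2)\in(K^*)^2 : 1+z_1+z_2=0\}\big)}\subset(\mathbb{C}^*)^2,$$ the closure being taken in $(\mathbb{C}^*)^2$. Then there is a continuous map $\Psi:H\times[0,1]\to(\mathbb{C}^*)^2$ such that the maps $\Psi_t:H\to(\mathbb{C}^*)^2$, $P\mapsto\Psi(P,t)$, satisfy: 1. $\Psi_0$ is the inclusion $H\hookrightarrow(\mathbb{C}^*)^2$; 2. $\Psi_1(H)=H_{trop}$;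 3. for each $t\in[0,1]$, $\Psi_t$ is a homeomorphism onto its image. In this sense $H$ and $H_{trop}$ are isotopic. -/

import Mathlib

open Topology

noncomputable section

namespace PhaseTropical

/-- The field `K` of (real-power) Puiseux series `∑_{j ∈ I} c_j t ^ j` with complex coefficients,
where `I ⊆ ℝ` is well ordered: functions `ℝ → ℂ` with well-ordered support. -/
abbrev PuiseuxReal : Type := HahnSeries ℝ ℂ

/-- The torus `(ℂ*)²`, with its usual topology. -/
abbrev Torus : Type := ℂˣ × ℂˣ

/-- The complexified valuation `K* → ℂ*`. A series with lowest term `c t ^ j`, `c ≠ 0`, is sent to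
`exp (-j + i arg c)`. -/
def val (z : PuiseuxRealˣ) : ℂˣ :=
  Units.mk0
    (Complex.exp (-((z : PuiseuxReal).order : ℂ)
      + Complex.I * ((z : PuiseuxReal).leadingCoeff.arg : ℂ)))
    (Complex.exp_ne_zero _)

/-- The complexified valuation applied in each of the two coordinates. -/
def val₂ (p : PuiseuxRealˣ × PuiseuxRealˣ) : Torus := (val p.1, val p.2)

/-- The line `1 + z₁ + z₂ = 0` in `(ℂ*)²`. -/
def complexLine : Set Torus := {p | 1 + (p.1 : ℂ) + (p.2 : ℂ) = 0}

/-- The zero set of `1 + z₁ + z₂` in `(K*)²`. -/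
def puiseuxLine : Set (PuiseuxRealˣ × PuiseuxRealˣ) :=
  {p | 1 + (p.1 : PuiseuxReal) + (p.2 : PuiseuxReal) = 0}

/-- The phase tropical line: the closure in `(ℂ*)²` of the image of `puiseuxLine` under the
complexified valuation. -/
def phaseTropicalLine : Set Torus := closure (val₂ '' puiseuxLine)

end PhaseTropical

end

open scoped Real

noncomputable section

namespace PhaseTropical

/-! ### Normalized side lengths and their tropical counterparts -/

/-! A point of `complexLine` is a triangle with sides `1, z₁, z₂`, determined up to complex
conjugation by its side lengths. Each closed half, `im z₁ ≥ 0` or `im z₁ ≤ 0`, is thus the space of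
triangle shapes, and the two meet in the degenerate shapes, the real points. A half of the phase
tropical line has a similar description, `TropData`: a closed triangle of angles `α` with sum `π`,
to whose edge `α i = 0` a half-strip with coordinate `X i ≤ 0` is glued.

Sort a shape into logarithmic sides `-s ≤ 0 ≤ r`. Then `k = (exp r - 1) * exp s`, the `defect`, lies
in `[0, 1]`, and `k = 1` means degenerate. The target angles `q ≤ p ≤ P` are fixed by `(P - p) / (P
+ p) = k` and `2 * (p - q) = min s (π * (1 - k))`, the `drop`. The cap is the value at which `q`
reaches `0`; what remains of `s` becomes the length `X = -(s - drop)`. The formulas are symmetric in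
the sides, hence continuous where the order of the sides changes, and they give a bijection of
shapes with `TropData` (`Arranged.tropData`, `Arranged.eq_of_tropical_eq`,
`TropData.exists_arranged`).

The isotopy interpolates linearly both logarithmic lengths and absolute values of arguments. For `t
< 1` the lengths alone determine the shape (`mixLength_injective`); at `t = 1` lengths and angles do
so together. Real points keep their arguments `0` or `π`, so the halves glue; a nonreal point never
gets two real coordinates, so nothing else is identified. Lengths move by at most `π`, so every
stage is proper and a closed embedding. In particular the final image `tropicalSet` is closed; it
contains all valuations, and they are dense in it (`phaseTropicalLine_eq`). -/

/-- The negative part of the logarithmic side lengths. -/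
def depth (x : Fin 3 → ℝ) (i : Fin 3) : ℝ := max (-x i) 0

/-- The amount by which a side exceeds the middle side, relative to the shortest one. -/
def excess (x : Fin 3 → ℝ) (i : Fin 3) : ℝ :=
  (Real.exp (max (x i) 0) - 1) * Real.exp (∑ j, depth x j)

/-- The total excess; it is `1` exactly for degenerate triangles. -/
def defect (x : Fin 3 → ℝ) : ℝ := ∑ i, excess x i

/-- The part of the depth which is turned into an angle. -/
def drop (x : Fin 3 → ℝ) (i : Fin 3) : ℝ := min (depth x i) (π * (1 - defect x))

/-- The sum of the two largest tropical angles. -/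
def scale (x : Fin 3 → ℝ) : ℝ := (2 * π + ∑ i, drop x i) / (3 - defect x)

/-- The angles of the point of the tropical line associated with a triangle. -/
def tropAngle (x : Fin 3 → ℝ) (i : Fin 3) : ℝ :=
  (1 - defect x) * scale x / 2 + excess x i * scale x - drop x i / 2

/-- The logarithmic lengths of the point of the tropical line associated with a triangle. -/
def tropLength (x : Fin 3 → ℝ) (i : Fin 3) : ℝ := drop x i - depth x i

/-- The interpolation between logarithmic lengths and tropical lengths. -/
def mixLength (t : ℝ) (x : Fin 3 → ℝ) (i : Fin 3) : ℝ := (1 - t) * x i + t * tropLength x i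

/-- `x` is, up to the permutation `e`, the triple `(-s, 0, r)` of logarithmic side lengths of a
triangle, the middle side having length one. -/
structure Arranged (e : Equiv.Perm (Fin 3)) (s r : ℝ) (x : Fin 3 → ℝ) : Prop where
  low : x (e 0) = -s
  mid : x (e 1) = 0
  high : x (e 2) = r
  s_nonneg : 0 ≤ s
  r_nonneg : 0 ≤ r
  triangle : Real.exp r - 1 ≤ Real.exp (-s)

/-- Lengths and angles of the points of the upper half of the phase tropical line. -/
structure TropData (X α : Fin 3 → ℝ) : Prop where
  nonpos : ∀ i, X i ≤ 0
  nonneg : ∀ i, 0 ≤ α i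
  sum_eq : ∑ i, α i = π
  angle_eq_zero : ∀ i, X i < 0 → α i = 0
  eq_zero_or : ∀ i j, i ≠ j → X i = 0 ∨ X j = 0

/-! ### Elementary bounds, and recovering a shape from interpolated lengths -/

lemma sum_perm (e : Equiv.Perm (Fin 3)) (f : Fin 3 → ℝ) :
    ∑ i, f i = f (e 0) + f (e 1) + f (e 2) := by
  rw [← Equiv.sum_comp e, Fin.sum_univ_three]

lemma forall_perm (e : Equiv.Perm (Fin 3)) {p : Fin 3 → Prop} (h0 : p (e 0)) (h1 : p (e 1))
    (h2 : p (e 2)) (i : Fin 3) : p i := by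
  obtain ⟨j, rfl⟩ := e.surjective i
  fin_cases j <;> assumption

lemma depth_nonneg (x : Fin 3 → ℝ) (i : Fin 3) : 0 ≤ depth x i := le_max_right _ _

lemma excess_nonneg (x : Fin 3 → ℝ) (i : Fin 3) : 0 ≤ excess x i :=
  mul_nonneg (sub_nonneg.2 (Real.one_le_exp (le_max_right _ _))) (Real.exp_pos _).le

lemma defect_nonneg (x : Fin 3 → ℝ) : 0 ≤ defect x := Finset.sum_nonneg fun i _ => excess_nonneg x i

lemma drop_le_depth (x : Fin 3 → ℝ) (i : Fin 3) : drop x i ≤ depth x i := min_le_left _ _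

lemma drop_nonneg {x : Fin 3 → ℝ} (hx : defect x ≤ 1) (i : Fin 3) : 0 ≤ drop x i :=
  le_min (depth_nonneg x i) (mul_nonneg Real.pi_pos.le (by linarith))

lemma drop_le_pi (x : Fin 3 → ℝ) (i : Fin 3) : drop x i ≤ π := by
  refine (min_le_right _ _).trans ?_
  nlinarith [Real.pi_pos, defect_nonneg x]

lemma tropLength_nonpos (x : Fin 3 → ℝ) (i : Fin 3) : tropLength x i ≤ 0 :=
  sub_nonpos.2 (drop_le_depth x i)

lemma depth_eq_zero {x : Fin 3 → ℝ} {i : Fin 3} (h : 0 ≤ x i) : depth x i = 0 :=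
  max_eq_right (by linarith)

lemma depth_eq_neg {x : Fin 3 → ℝ} {i : Fin 3} (h : x i ≤ 0) : depth x i = -x i :=
  max_eq_left (by linarith)

lemma excess_eq_zero {x : Fin 3 → ℝ} {i : Fin 3} (h : x i ≤ 0) : excess x i = 0 := by
  simp [excess, max_eq_right h]

lemma drop_eq_zero {x : Fin 3 → ℝ} (hx : defect x ≤ 1) {i : Fin 3} (h : 0 ≤ x i) :
    drop x i = 0 := by
  rw [drop, depth_eq_zero h, min_eq_left (mul_nonneg Real.pi_pos.le (by linarith))]

lemma posPart_mixLength {x : Fin 3 → ℝ} (hx : defect x ≤ 1) {t : ℝ} (h0 : 0 ≤ t) (h1 : t ≤ 1)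
    (i : Fin 3) : max (mixLength t x i) 0 = (1 - t) * max (x i) 0 := by
  rcases le_total 0 (x i) with h | h
  · rw [mixLength, tropLength, drop_eq_zero hx h, depth_eq_zero h, max_eq_left h]
    simpa using mul_nonneg (sub_nonneg.2 h1) h
  · rw [max_eq_right h, max_eq_right, mul_zero]
    have := tropLength_nonpos x i
    rw [mixLength]
    nlinarith

/-- Splits the interpolated length into positive and negative parts; the latter is nondecreasing in
both `depth` and `defect`, which is what drives injectivity. -/
lemma mixLength_eq (t : ℝ) (x : Fin 3 → ℝ) (i : Fin 3) :
    mixLength t x i = (1 - t) * max (x i) 0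
      - ((1 - t) * depth x i + t * max (depth x i - π * (1 - defect x)) 0) := by
  have h1 : x i = max (x i) 0 - depth x i := by
    rcases le_total 0 (x i) with h | h
    · rw [depth_eq_zero h, max_eq_left h]; ring
    · rw [depth_eq_neg h, max_eq_right h]; ring
  have h2 : tropLength x i = -max (depth x i - π * (1 - defect x)) 0 := by
    rw [tropLength, drop, max_def, min_def]
    split_ifs <;> linarith
  rw [mixLength, h2]
  nth_rw 1 [h1]
  ring

/-- For `t < 1` the term `(1 - t) * depth` makes the negative part strictly increasing in the depth.
-/
lemma depth_le_of_mixLength_eq {x y : Fin 3 → ℝ} {t : ℝ} (h0 : 0 ≤ t) (h1 : t < 1)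
    (hk : defect x ≤ defect y) {i : Fin 3} (hp : max (x i) 0 = max (y i) 0)
    (h : mixLength t x i = mixLength t y i) : depth y i ≤ depth x i := by
  by_contra! hlt
  rw [mixLength_eq, mixLength_eq, hp] at h
  have h2 : max (depth x i - π * (1 - defect x)) 0 ≤ max (depth y i - π * (1 - defect y)) 0 := by
    apply max_le_max _ le_rfl
    nlinarith [Real.pi_pos]
  nlinarith

lemma defect_eq (x : Fin 3 → ℝ) :
    defect x = (∑ i, (Real.exp (max (x i) 0) - 1)) * Real.exp (∑ j, depth x j) := by
  rw [defect, Finset.sum_mul]; rfl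

lemma eq_of_posPart_of_depth {x y : Fin 3 → ℝ} (hp : ∀ i, max (x i) 0 = max (y i) 0)
    (hd : ∀ i, depth x i = depth y i) : x = y := by
  have key : ∀ (z : Fin 3 → ℝ) (i : Fin 3), z i = max (z i) 0 - depth z i := fun z i => by
    rcases le_total 0 (z i) with h | h
    · rw [depth_eq_zero h, max_eq_left h]; ring
    · rw [depth_eq_neg h, max_eq_right h]; ring
  ext i
  rw [key x, key y, hp, hd]

/-- Before the end of the isotopy, the interpolated lengths determine the triangle. -/
lemma mixLength_injective {x y : Fin 3 → ℝ} (hx : defect x ≤ 1) (hy : defect y ≤ 1) {t : ℝ}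
    (h0 : 0 ≤ t) (h1 : t < 1) (h : mixLength t x = mixLength t y) : x = y := by
  wlog hS : ∑ i, depth x i ≤ ∑ i, depth y i generalizing x y
  · exact (this hy hx h.symm (le_of_not_ge hS)).symm
  have hp : ∀ i, max (x i) 0 = max (y i) 0 := fun i => by
    have e : max (mixLength t x i) 0 = max (mixLength t y i) 0 := by rw [h]
    rw [posPart_mixLength hx h0 h1.le, posPart_mixLength hy h0 h1.le] at e
    exact mul_left_cancel₀ (by linarith) e
  -- With equal positive parts, the defect depends only on the total depth, and increases with it.
  have hk : defect x ≤ defect y := by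
    rw [defect_eq, defect_eq]
    simp only [hp]
    refine mul_le_mul_of_nonneg_left (Real.exp_le_exp.2 hS) (Finset.sum_nonneg fun i _ => ?_)
    exact sub_nonneg.2 (Real.one_le_exp (le_max_right _ _))
  have hd : ∀ i, depth y i ≤ depth x i := fun i =>
    depth_le_of_mixLength_eq h0 h1 hk (hp i) (congrFun h i)
  -- The depths compare one way termwise and the other way in total, so all of them agree.
  have hsum : ∑ i, depth y i = ∑ i, depth x i :=
    le_antisymm (Finset.sum_le_sum fun i _ => hd i) hS
  refine eq_of_posPart_of_depth hp fun i => ?_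
  exact ((Finset.sum_eq_sum_iff_of_le fun i _ => hd i).1 hsum i (Finset.mem_univ i)).symm

/-! ### Shapes in sorted coordinates -/

namespace Arranged

variable {e : Equiv.Perm (Fin 3)} {s r : ℝ} {x : Fin 3 → ℝ} (h : Arranged e s r x)
include h

lemma depth_low : depth x (e 0) = s := by
  rw [depth_eq_neg (by rw [h.low]; linarith [h.s_nonneg]), h.low, neg_neg]

lemma depth_mid : depth x (e 1) = 0 := depth_eq_zero h.mid.ge

lemma depth_high : depth x (e 2) = 0 := depth_eq_zero (h.high ▸ h.r_nonneg)

lemma sum_depth : ∑ i, depth x i = s := by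
  rw [sum_perm e, h.depth_low, h.depth_mid, h.depth_high]; ring

lemma excess_low : excess x (e 0) = 0 := excess_eq_zero (by rw [h.low]; linarith [h.s_nonneg])

lemma excess_mid : excess x (e 1) = 0 := excess_eq_zero h.mid.le

lemma excess_high : excess x (e 2) = (Real.exp r - 1) * Real.exp s := by
  rw [excess, h.sum_depth, h.high, max_eq_left h.r_nonneg]

lemma defect_eq : defect x = (Real.exp r - 1) * Real.exp s := by
  rw [defect, sum_perm e, h.excess_low, h.excess_mid, h.excess_high]; ring

lemma excess_high_eq : excess x (e 2) = defect x := by rw [h.excess_high, h.defect_eq]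

lemma defect_le_one : defect x ≤ 1 := by
  rw [h.defect_eq]
  have := mul_le_mul_of_nonneg_right h.triangle (Real.exp_pos s).le
  rwa [← Real.exp_add, neg_add_cancel, Real.exp_zero] at this

lemma drop_mid : drop x (e 1) = 0 := drop_eq_zero h.defect_le_one h.mid.ge

lemma drop_high : drop x (e 2) = 0 := drop_eq_zero h.defect_le_one (h.high ▸ h.r_nonneg)

lemma drop_low : drop x (e 0) = min s (π * (1 - defect x)) := by rw [drop, h.depth_low]

lemma sum_drop : ∑ i, drop x i = drop x (e 0) := by
  rw [sum_perm e, h.drop_mid, h.drop_high]; ring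

lemma scale_mul : scale x * (3 - defect x) = 2 * π + drop x (e 0) := by
  rw [scale, h.sum_drop, div_mul_cancel₀]
  linarith [h.defect_le_one]

lemma scale_pos : 0 < scale x := by
  have h1 := h.scale_mul
  have h2 := drop_nonneg h.defect_le_one (e 0)
  have h3 := h.defect_le_one
  have := Real.pi_pos
  by_contra! hle
  nlinarith

lemma tropAngle_low : tropAngle x (e 0) = π - scale x := by
  rw [tropAngle, h.excess_low]
  linarith [h.scale_mul]

lemma tropAngle_mid : tropAngle x (e 1) = (1 - defect x) * scale x / 2 := by
  rw [tropAngle, h.excess_mid, h.drop_mid]; ring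

lemma tropAngle_high : tropAngle x (e 2) = (1 + defect x) * scale x / 2 := by
  rw [tropAngle, h.excess_high_eq, h.drop_high]; ring

/-- The cap `π * (1 - defect x)` on the drop is chosen for this: `2 * π + π * (1 - k) = π * (3 -
k)`, so the smallest angle `π - scale x` stays nonnegative and vanishes exactly at the cap. -/
lemma scale_le_pi : scale x ≤ π := by
  have h1 := h.scale_mul
  have h3 := h.defect_le_one
  have h4 : drop x (e 0) ≤ π * (1 - defect x) := min_le_right _ _
  by_contra! hlt
  nlinarith

lemma tropAngle_low_le_mid : tropAngle x (e 0) ≤ tropAngle x (e 1) := by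
  have h2 := drop_nonneg h.defect_le_one (e 0)
  rw [tropAngle, tropAngle, h.excess_low, h.excess_mid, h.drop_mid]
  linarith

lemma tropAngle_mid_le_high : tropAngle x (e 1) ≤ tropAngle x (e 2) := by
  rw [h.tropAngle_mid, h.tropAngle_high]
  nlinarith [h.scale_pos, defect_nonneg x]

/-- Together with `tropAngle_le`, this reads off `scale` and `defect` from the extreme angles
without reference to the sorting permutation. -/
lemma le_tropAngle (i : Fin 3) : π - scale x ≤ tropAngle x i := by
  rw [← h.tropAngle_low]
  exact forall_perm e (p := fun i => tropAngle x (e 0) ≤ tropAngle x i) le_rfl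
    h.tropAngle_low_le_mid (h.tropAngle_low_le_mid.trans h.tropAngle_mid_le_high) i

lemma tropAngle_le (i : Fin 3) : tropAngle x i ≤ (1 + defect x) * scale x / 2 := by
  rw [← h.tropAngle_high]
  exact forall_perm e (p := fun i => tropAngle x i ≤ tropAngle x (e 2))
    (h.tropAngle_low_le_mid.trans h.tropAngle_mid_le_high) h.tropAngle_mid_le_high le_rfl i

lemma tropLength_mid : tropLength x (e 1) = 0 := by
  rw [tropLength, h.drop_mid, h.depth_mid, sub_zero]

lemma tropLength_high : tropLength x (e 2) = 0 := by
  rw [tropLength, h.drop_high, h.depth_high, sub_zero]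

lemma tropData : TropData (tropLength x) (tropAngle x) where
  nonpos := tropLength_nonpos x
  nonneg i := (sub_nonneg.2 h.scale_le_pi).trans (h.le_tropAngle i)
  sum_eq := by
    rw [sum_perm e, h.tropAngle_low, h.tropAngle_mid, h.tropAngle_high]; ring
  angle_eq_zero := by
    refine forall_perm e ?_ (fun h1 => absurd h.tropLength_mid h1.ne)
      (fun h1 => absurd h.tropLength_high h1.ne)
    intro h1
    -- A negative length means that the cap is attained, hence `scale x = π` and the smallest angle
    -- is zero.
    rw [tropLength, sub_neg, drop, min_lt_iff] at h1
    have h2 : drop x (e 0) = π * (1 - defect x) :=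
      min_eq_right (h1.resolve_left (lt_irrefl _)).le
    have h3 := h.scale_mul
    have h4 := h.defect_le_one
    rw [h2] at h3
    have : scale x = π := mul_right_cancel₀ (b := 3 - defect x) (by linarith) (by linarith)
    rw [h.tropAngle_low, this, sub_self]
  eq_zero_or := by
    have key : ∀ i, i ≠ e 0 → tropLength x i = 0 :=
      forall_perm e (fun h => absurd rfl h) (fun _ => h.tropLength_mid) fun _ => h.tropLength_high
    intro i j hij
    by_cases hi : i = e 0
    · exact Or.inr (key j fun hj => hij (hi.trans hj.symm))
    · exact Or.inl (key i hi)

/-- Excess lives on the longest side and drop on the shortest, so their contributions to an angle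
can be told apart. -/
lemma excess_mul_drop (i : Fin 3) : excess x i * drop x i = 0 :=
  forall_perm e (p := fun i => excess x i * drop x i = 0) (by rw [h.excess_low, zero_mul])
    (by rw [h.drop_mid, mul_zero]) (by rw [h.drop_high, mul_zero]) i

end Arranged

/-! ### Bijection between shapes and tropical data -/

/-- Tropical lengths and angles determine the triangle. -/
lemma Arranged.eq_of_tropical_eq {e e' : Equiv.Perm (Fin 3)} {s r s' r' : ℝ} {x y : Fin 3 → ℝ}
    (hx : Arranged e s r x) (hy : Arranged e' s' r' y) (hL : tropLength x = tropLength y)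
    (hA : tropAngle x = tropAngle y) : x = y := by
  -- The smallest angle is `π - scale`, whichever permutation sorts the sides; the largest one then
  -- gives the defect.
  have hn : scale x = scale y := by
    apply le_antisymm
    · have := hy.le_tropAngle (e 0); rw [← hA, hx.tropAngle_low] at this; linarith
    · have := hx.le_tropAngle (e' 0); rw [hA, hy.tropAngle_low] at this; linarith
  have hpos := hy.scale_pos
  have hk : defect x = defect y := by
    have h1 := hx.tropAngle_le (e' 2)
    have h2 := hy.tropAngle_le (e 2)
    rw [hA, hy.tropAngle_high, hn] at h1
    rw [← hA, hx.tropAngle_high, hn] at h2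
    nlinarith
  -- What is left of each angle is `excess * scale - drop / 2`, a difference of nonnegative terms of
  -- which at most one is nonzero.
  have hdrop : ∀ i, drop x i = drop y i ∧ excess x i = excess y i := fun i => by
    have h1 := congrFun hA i
    rw [tropAngle, tropAngle, hn, hk] at h1
    have h2 := hx.excess_mul_drop i
    have h3 := hy.excess_mul_drop i
    have h4 := excess_nonneg x i
    have h5 := excess_nonneg y i
    have h6 := drop_nonneg hx.defect_le_one i
    have h7 := drop_nonneg hy.defect_le_one i
    rcases mul_eq_zero.1 h2 with h | h <;> rcases mul_eq_zero.1 h3 with h' | h' <;>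
      rw [h, h'] at h1 ⊢
    · exact ⟨by linarith, rfl⟩
    · have : 0 ≤ excess y i * scale y := mul_nonneg h5 hpos.le
      have h8 : drop x i = 0 := by linarith
      have h9 : excess y i * scale y = 0 := by linarith
      exact ⟨h8, ((mul_eq_zero.1 h9).resolve_right hpos.ne').symm⟩
    · have : 0 ≤ excess x i * scale y := mul_nonneg h4 hpos.le
      have h8 : drop y i = 0 := by linarith
      have h9 : excess x i * scale y = 0 := by linarith
      exact ⟨h8.symm, (mul_eq_zero.1 h9).resolve_right hpos.ne'⟩
    · exact ⟨rfl, mul_right_cancel₀ hpos.ne' (by linarith)⟩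
  have hd : ∀ i, depth x i = depth y i := fun i => by
    have := congrFun hL i
    rw [tropLength, tropLength, (hdrop i).1] at this
    linarith
  refine eq_of_posPart_of_depth (fun i => ?_) hd
  have h1 := (hdrop i).2
  simp only [excess, hd] at h1
  have h2 := mul_right_cancel₀ (Real.exp_ne_zero _) h1
  exact Real.exp_injective (by linarith)

/-- Every point of the upper half of the tropical line comes from a triangle. -/
lemma TropData.exists_arranged {X α : Fin 3 → ℝ} (h : TropData X α) :
    ∃ e s r x, Arranged e s r x ∧ tropLength x = X ∧ tropAngle x = α := by
  -- Sorting by `α + X` puts a side with negative length first, since its angle is zero, and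
  -- otherwise sorts the angles.
  obtain ⟨e, he⟩ : ∃ e : Equiv.Perm (Fin 3), Monotone ((α + X) ∘ e) :=
    ⟨_, Tuple.monotone_sort (α + X)⟩
  have h01 : α (e 0) + X (e 0) ≤ α (e 1) + X (e 1) := he (show (0 : Fin 3) ≤ 1 by decide)
  have h12 : α (e 1) + X (e 1) ≤ α (e 2) + X (e 2) := he (show (1 : Fin 3) ≤ 2 by decide)
  have hX1 : X (e 1) = 0 := by
    by_contra hne
    have hlt := lt_of_le_of_ne (h.nonpos _) hne
    have h0 := (h.eq_zero_or (e 0) (e 1) (by simp)).resolve_right hne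
    linarith [h.angle_eq_zero _ hlt, h.nonneg (e 0)]
  have hX2 : X (e 2) = 0 := by
    by_contra hne
    have hlt := lt_of_le_of_ne (h.nonpos _) hne
    linarith [h.angle_eq_zero _ hlt, h.nonneg (e 1)]
  have hq := h.nonneg (e 0)
  have hle : α (e 0) ≤ α (e 1) := by
    rcases (h.nonpos (e 0)).lt_or_eq with hlt | h0
    · rw [h.angle_eq_zero _ hlt]; exact h.nonneg _
    · linarith
  have hle' : α (e 1) ≤ α (e 2) := by linarith
  have hsum := h.sum_eq
  rw [sum_perm e] at hsum
  have hpi := Real.pi_pos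
  set q := α (e 0)
  set p := α (e 1)
  set P := α (e 2)
  have hn : 0 < p + P := by linarith
  -- Solves `p = (1 - k) * n / 2` and `P = (1 + k) * n / 2` with `n = p + P`. Below, `s` is the
  -- required drop plus the length `-X (e 0)`, and `r` solves `(exp r - 1) * exp s = k`.
  set k := (P - p) / (P + p) with hk
  have hkn : k * (p + P) = P - p := by rw [hk, add_comm p P, div_mul_cancel₀]; linarith
  have hk0 : 0 ≤ k := div_nonneg (by linarith) (by linarith)
  have hk1 : k ≤ 1 := by
    rw [hk, div_le_one (by linarith)]; linarith
  set s := 2 * (p - q) - X (e 0) with hs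
  have hs0 : 0 ≤ s := by linarith [h.nonpos (e 0)]
  set r := Real.log (1 + k * Real.exp (-s)) with hr
  have hexp : Real.exp r = 1 + k * Real.exp (-s) := by
    rw [hr, Real.exp_log]
    have := mul_nonneg hk0 (Real.exp_pos (-s)).le
    linarith
  let x : Fin 3 → ℝ := ![-s, 0, r] ∘ e.symm
  have hx : Arranged e s r x :=
    { low := by simp [x]
      mid := by simp [x]
      high := by simp [x]
      s_nonneg := hs0
      r_nonneg := Real.log_nonneg (by
        have := mul_nonneg hk0 (Real.exp_pos (-s)).le
        linarith)
      triangle := by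
        rw [hexp]
        have := Real.exp_pos (-s)
        nlinarith }
  have hdef : defect x = k := by
    rw [hx.defect_eq, hexp, add_sub_cancel_left, mul_assoc, ← Real.exp_add, neg_add_cancel,
      Real.exp_zero, mul_one]
  -- The gap between the cap and the required drop is a nonnegative multiple of `q`. If `X (e 0) <
  -- 0` then `q = 0` and the cap is attained; if `X (e 0) = 0` then `s` is below the cap.
  have hkey : (p + P) * (π * (1 - k) - 2 * (p - q)) = 2 * q * (2 * p + P) := by
    have : π = q + p + P := hsum.symm
    rw [this]
    linear_combination (-(q + p + P)) * hkn
  have hdrop : drop x (e 0) = 2 * (p - q) := by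
    rw [hx.drop_low, hdef]
    rcases (h.nonpos (e 0)).lt_or_eq with hlt | h0
    · have hq0 : q = 0 := h.angle_eq_zero _ hlt
      rw [hq0] at hkey
      have h1 : π * (1 - k) - 2 * (p - 0) = 0 := by
        have : (p + P) * (π * (1 - k) - 2 * (p - 0)) = 0 := by rw [hkey]; ring
        exact (mul_eq_zero.1 this).resolve_left hn.ne'
      rw [min_eq_right] <;> linarith
    · rw [hs, h0, sub_zero, min_eq_left]
      by_contra! hlt
      have : 0 ≤ 2 * q * (2 * p + P) := mul_nonneg (by linarith) (by linarith)
      nlinarith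
  have hscale : scale x = p + P := by
    have h1 := hx.scale_mul
    rw [hdrop, hdef] at h1
    refine mul_right_cancel₀ (b := 3 - k) (by linarith) ?_
    rw [h1, ← hsum]
    linear_combination hkn
  refine ⟨e, s, r, x, hx, ?_, ?_⟩
  · refine funext (forall_perm e ?_ ?_ ?_)
    · rw [tropLength, hdrop, hx.depth_low, hs]; ring
    · rw [hx.tropLength_mid, hX1]
    · rw [hx.tropLength_high, hX2]
  · refine funext (forall_perm e ?_ ?_ ?_)
    · rw [hx.tropAngle_low, hscale]; linarith
    · rw [hx.tropAngle_mid, hscale, hdef]; linarith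
    · rw [hx.tropAngle_high, hscale, hdef]; linarith

/-! ### The isotopy -/

/-- The middle one of three real numbers. -/
def middle (v : Fin 3 → ℝ) : ℝ :=
  ∑ i, v i - Finset.univ.sup' Finset.univ_nonempty v - Finset.univ.inf' Finset.univ_nonempty v

/-- The logarithms of the side lengths of the triangle with sides `1`, `z₁`, `z₂`. -/
def logSide (P : Torus) : Fin 3 → ℝ := ![0, Real.log ‖(P.1 : ℂ)‖, Real.log ‖(P.2 : ℂ)‖]

/-- The logarithmic side lengths, the middle one being normalized to zero. -/
def side (P : Torus) (i : Fin 3) : ℝ := logSide P i - middle (logSide P)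

/-- The point of the torus with logarithmic homogeneous coordinates `X` and arguments `a`, `b`. -/
def point (X : Fin 3 → ℝ) (a b : ℝ) : Torus :=
  (Units.mk0 (Complex.exp ((X 1 - X 0 : ℝ) + a * Complex.I)) (Complex.exp_ne_zero _),
    Units.mk0 (Complex.exp ((X 2 - X 0 : ℝ) + b * Complex.I)) (Complex.exp_ne_zero _))

/-- The absolute value of the argument of the first coordinate during the isotopy. -/
def turnFst (t : ℝ) (P : Torus) : ℝ :=
  (1 - t) * |(P.1 : ℂ).arg| + t * (π - tropAngle (side P) 2)

/-- The absolute value of the argument of the second coordinate during the isotopy. -/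
def turnSnd (t : ℝ) (P : Torus) : ℝ :=
  (1 - t) * |(P.2 : ℂ).arg| + t * (π - tropAngle (side P) 1)

/-- The isotopy on the upper half of the line. -/
def upperIsotopy (t : ℝ) (P : Torus) : Torus :=
  point (mixLength t (side P)) (turnFst t P) (-turnSnd t P)

/-- The isotopy on the lower half of the line. -/
def lowerIsotopy (t : ℝ) (P : Torus) : Torus :=
  point (mixLength t (side P)) (-turnFst t P) (turnSnd t P)

open Classical in
/-- The isotopy from the line to the phase tropical line. -/
def isotopy (t : ℝ) (P : Torus) : Torus :=
  if 0 ≤ (P.1 : ℂ).im then upperIsotopy t P else lowerIsotopy t P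

/-! ### Side lengths of points of the line -/

lemma middle_eq {v : Fin 3 → ℝ} (e : Equiv.Perm (Fin 3)) (h0 : v (e 0) ≤ v (e 1))
    (h1 : v (e 1) ≤ v (e 2)) : middle v = v (e 1) := by
  have hs : Finset.univ.sup' Finset.univ_nonempty v = v (e 2) :=
    le_antisymm (Finset.sup'_le _ _ fun i _ =>
      forall_perm e (p := fun i => v i ≤ v (e 2)) (h0.trans h1) h1 le_rfl i)
      (Finset.le_sup' v (Finset.mem_univ _))
  have hi : Finset.univ.inf' Finset.univ_nonempty v = v (e 0) :=
    le_antisymm (Finset.inf'_le v (Finset.mem_univ _)) (Finset.le_inf' _ _ fun i _ =>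
      forall_perm e (p := fun i => v (e 0) ≤ v i) le_rfl h0 (h0.trans h1) i)
  rw [middle, hs, hi, sum_perm e]
  ring

lemma exists_sorting (v : Fin 3 → ℝ) :
    ∃ e : Equiv.Perm (Fin 3), v (e 0) ≤ v (e 1) ∧ v (e 1) ≤ v (e 2) :=
  ⟨Tuple.sort v, Tuple.monotone_sort v (show (0 : Fin 3) ≤ 1 by decide),
    Tuple.monotone_sort v (show (1 : Fin 3) ≤ 2 by decide)⟩

lemma middle_sub (v : Fin 3 → ℝ) (c : ℝ) : middle (fun i => v i - c) = middle v - c := by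
  obtain ⟨e, h0, h1⟩ := exists_sorting v
  rw [middle_eq e h0 h1, middle_eq e (by simpa using h0) (by simpa using h1)]

/-- The torus only sees differences of the homogeneous coordinates; a vanishing middle value picks
one representative. -/
lemma eq_of_sub_eq {X Y : Fin 3 → ℝ} (hX : middle X = 0) (hY : middle Y = 0)
    (h1 : X 1 - X 0 = Y 1 - Y 0) (h2 : X 2 - X 0 = Y 2 - Y 0) : X = Y := by
  have h : Y = fun i => X i - (X 0 - Y 0) := by
    ext i
    fin_cases i
    · simp
    · simp only [Fin.mk_one]; linarith
    · simp only [Fin.reduceFinMk]; linarith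
  have hc : X 0 - Y 0 = 0 := by
    rw [h, middle_sub, hX] at hY
    linarith
  rw [h, hc]
  simp

lemma middle_side (P : Torus) : middle (side P) = 0 := by
  rw [show side P = fun i => logSide P i - middle (logSide P) from rfl, middle_sub, sub_self]

lemma side_sub (P : Torus) (i : Fin 3) : side P i - side P 0 = logSide P i := by
  simp [side, logSide]

lemma norm_eq_of_side_eq {P Q : Torus} (h : side P = side Q) :
    ‖(P.1 : ℂ)‖ = ‖(Q.1 : ℂ)‖ ∧ ‖(P.2 : ℂ)‖ = ‖(Q.2 : ℂ)‖ := by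
  have key : ∀ i, logSide P i = logSide Q i := fun i => by rw [← side_sub, ← side_sub, h]
  exact ⟨Real.log_injOn_pos (norm_pos_iff.2 P.1.ne_zero) (norm_pos_iff.2 Q.1.ne_zero) (key 1),
    Real.log_injOn_pos (norm_pos_iff.2 P.2.ne_zero) (norm_pos_iff.2 Q.2.ne_zero) (key 2)⟩

lemma exp_logSide (P : Torus) (i : Fin 3) :
    Real.exp (logSide P i) = ‖(![1, (P.1 : ℂ), (P.2 : ℂ)] : Fin 3 → ℂ) i‖ := by
  fin_cases i
  · simp [logSide]
  · simp [logSide, Real.exp_log (norm_pos_iff.2 P.1.ne_zero)]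
  · simp [logSide, Real.exp_log (norm_pos_iff.2 P.2.ne_zero)]

lemma sum_exp_logSide (P : Torus) :
    ∑ i, Real.exp (logSide P i) = 1 + ‖(P.1 : ℂ)‖ + ‖(P.2 : ℂ)‖ := by
  simp [Fin.sum_univ_three, exp_logSide]

lemma exp_logSide_le {P : Torus} (hP : P ∈ complexLine) (e : Equiv.Perm (Fin 3)) :
    Real.exp (logSide P (e 2)) ≤ Real.exp (logSide P (e 0)) + Real.exp (logSide P (e 1)) := by
  simp only [exp_logSide]
  set z : Fin 3 → ℂ := ![1, (P.1 : ℂ), (P.2 : ℂ)] with hz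
  have hsum : ∑ i, z i = 0 := by
    rw [Fin.sum_univ_three]
    exact hP
  rw [← Equiv.sum_comp e, Fin.sum_univ_three] at hsum
  rw [eq_neg_of_add_eq_zero_right hsum, norm_neg]
  exact norm_add_le _ _

/-- The sides of a point of the line are the sides of a triangle. -/
lemma exists_arranged_side {P : Torus} (hP : P ∈ complexLine) :
    ∃ e s r, Arranged e s r (side P) := by
  obtain ⟨e, h0, h1⟩ := exists_sorting (logSide P)
  have hm := middle_eq e h0 h1
  refine ⟨e, logSide P (e 1) - logSide P (e 0), logSide P (e 2) - logSide P (e 1),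
    { low := by rw [side, hm]; ring
      mid := by rw [side, hm]; ring
      high := by rw [side, hm]
      s_nonneg := by linarith
      r_nonneg := by linarith
      triangle := ?_ }⟩
  have h := exp_logSide_le hP e
  rw [neg_sub, Real.exp_sub, Real.exp_sub, sub_le_iff_le_add, div_add_one (Real.exp_ne_zero _)]
  exact div_le_div_of_nonneg_right h (Real.exp_pos _).le

lemma defect_side_le_one {P : Torus} (hP : P ∈ complexLine) : defect (side P) ≤ 1 := by
  obtain ⟨e, s, r, h⟩ := exists_arranged_side hP
  exact h.defect_le_one

lemma Arranged.sum_exp_logSide_eq {P : Torus} {e : Equiv.Perm (Fin 3)} {s r : ℝ}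
    (h : Arranged e s r (side P)) (hk : defect (side P) = 1) :
    ∑ i, Real.exp (logSide P i) = 2 * Real.exp (logSide P (e 2)) := by
  rw [h.defect_eq] at hk
  have hr : Real.exp r = 1 + Real.exp (-s) := by
    rw [Real.exp_neg]
    field_simp
    linarith
  have h0 : logSide P (e 0) = middle (logSide P) + -s := by rw [← h.low, side]; ring
  have h1 : logSide P (e 1) = middle (logSide P) := by
    have := h.mid; rw [side] at this; linarith
  have h2 : logSide P (e 2) = middle (logSide P) + r := by rw [← h.high, side]; ring
  rw [sum_perm e, h0, h1, h2, Real.exp_add, Real.exp_add, hr]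
  ring

/-- The tropical angles of a degenerate triangle. -/
lemma tropAngle_of_degenerate {P : Torus} (hP : P ∈ complexLine) {i : Fin 3}
    (hi : ∑ j, Real.exp (logSide P j) = 2 * Real.exp (logSide P i)) :
    tropAngle (side P) = Pi.single i π := by
  obtain ⟨e, s, r, h⟩ := exists_arranged_side hP
  have h0 : logSide P (e 0) = middle (logSide P) + -s := by rw [← h.low, side]; ring
  have h1 : logSide P (e 1) = middle (logSide P) := by
    have := h.mid; rw [side] at this; linarith
  have h2 : logSide P (e 2) = middle (logSide P) + r := by rw [← h.high, side]; ring
  have hle0 : Real.exp (logSide P (e 0)) ≤ Real.exp (logSide P (e 1)) :=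
    Real.exp_le_exp.2 (by linarith [h.s_nonneg])
  have hle1 : Real.exp (logSide P (e 1)) ≤ Real.exp (logSide P (e 2)) :=
    Real.exp_le_exp.2 (by linarith [h.r_nonneg])
  -- Only the longest side can be half the perimeter, as all sides are positive.
  have hie : e 2 = i := by
    revert hi
    rw [sum_perm e]
    have p0 := Real.exp_pos (logSide P (e 0))
    have p1 := Real.exp_pos (logSide P (e 1))
    exact forall_perm e (p := fun i => _ = 2 * Real.exp (logSide P i) → e 2 = i)
      (fun _ => by linarith) (fun _ => by linarith) (fun _ => rfl) i
  subst hie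
  have hk : defect (side P) = 1 := by
    rw [sum_perm e, h0, h1, h2, Real.exp_add, Real.exp_add] at hi
    have hr : Real.exp r = 1 + Real.exp (-s) :=
      mul_left_cancel₀ (Real.exp_ne_zero (middle (logSide P))) (by linarith)
    rw [h.defect_eq, hr, add_sub_cancel_left, ← Real.exp_add, neg_add_cancel, Real.exp_zero]
  have hd : drop (side P) (e 0) = 0 := by
    rw [h.drop_low, hk, sub_self, mul_zero, min_eq_right h.s_nonneg]
  have hn : scale (side P) = π := by
    have := h.scale_mul
    rw [hk, hd] at this
    linarith
  refine funext (forall_perm e ?_ ?_ ?_)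
  · rw [h.tropAngle_low, hn, Pi.single_eq_of_ne (by simp), sub_self]
  · rw [h.tropAngle_mid, hk, Pi.single_eq_of_ne (by simp)]; ring
  · rw [h.tropAngle_high, hn, hk, Pi.single_eq_same]; ring

/-! ### Heron's formula and real points -/

lemma snd_eq {P : Torus} (hP : P ∈ complexLine) : (P.2 : ℂ) = -1 - P.1 := by
  have : 1 + (P.1 : ℂ) + P.2 = 0 := hP
  linear_combination this

lemma norm_fst_sq (P : Torus) : ‖(P.1 : ℂ)‖ ^ 2 = (P.1 : ℂ).re ^ 2 + (P.1 : ℂ).im ^ 2 := by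
  rw [Complex.sq_norm, Complex.normSq_apply]; ring

lemma norm_snd_sq {P : Torus} (hP : P ∈ complexLine) :
    ‖(P.2 : ℂ)‖ ^ 2 = (1 + (P.1 : ℂ).re) ^ 2 + (P.1 : ℂ).im ^ 2 := by
  rw [snd_eq hP, Complex.sq_norm, Complex.normSq_apply]
  simp
  ring

lemma im_snd {P : Torus} (hP : P ∈ complexLine) : (P.2 : ℂ).im = -(P.1 : ℂ).im := by
  rw [snd_eq hP]; simp

lemma re_snd {P : Torus} (hP : P ∈ complexLine) : (P.2 : ℂ).re = -1 - (P.1 : ℂ).re := by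
  rw [snd_eq hP]; simp

/-- The triangle has base `1` and height `|im z₁|`, so both sides are sixteen times its squared
area. -/
lemma heron {P : Torus} (hP : P ∈ complexLine) {a b : ℝ} (ha : ‖(P.1 : ℂ)‖ = a)
    (hb : ‖(P.2 : ℂ)‖ = b) :
    4 * (P.1 : ℂ).im ^ 2 = (1 + a + b) * (1 + a + b - 2) * (1 + a + b - 2 * a)
      * (1 + a + b - 2 * b) := by
  have h1 := norm_fst_sq P
  have h2 := norm_snd_sq hP
  rw [ha] at h1
  rw [hb] at h2
  have hre : (P.1 : ℂ).re = (b ^ 2 - a ^ 2 - 1) / 2 := by linarith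
  have him : (P.1 : ℂ).im ^ 2 = a ^ 2 - (P.1 : ℂ).re ^ 2 := by linarith
  rw [him, hre]
  ring

lemma im_eq_zero_of_degenerate {P : Torus} (hP : P ∈ complexLine) {i : Fin 3}
    (hi : ∑ j, Real.exp (logSide P j) = 2 * Real.exp (logSide P i)) : (P.1 : ℂ).im = 0 := by
  have h := heron hP rfl rfl
  rw [sum_exp_logSide, exp_logSide] at hi
  refine pow_eq_zero_iff two_ne_zero |>.1 (mul_eq_zero.1 (h.trans ?_) |>.resolve_left four_ne_zero)
  fin_cases i <;> simp at hi <;> rw [hi] <;> ring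

/-- The vertices of the triangle of angles come from real points. -/
lemma im_eq_zero_of_sin_tropAngle {P : Torus} (hP : P ∈ complexLine)
    (h1 : Real.sin (tropAngle (side P) 1) = 0) (h2 : Real.sin (tropAngle (side P) 2) = 0) :
    (P.1 : ℂ).im = 0 := by
  obtain ⟨e, s, r, h⟩ := exists_arranged_side hP
  have hT := h.tropData
  have hpi := Real.pi_pos
  have hle : ∀ i, tropAngle (side P) i ≤ π := fun i => by
    rw [← hT.sum_eq]
    exact Finset.single_le_sum (fun j _ => hT.nonneg j) (Finset.mem_univ i)
  have key : ∀ i, Real.sin (tropAngle (side P) i) = 0 →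
      tropAngle (side P) i = 0 ∨ tropAngle (side P) i = π := fun i hi => by
    by_contra! hne
    exact (Real.sin_pos_of_pos_of_lt_pi (lt_of_le_of_ne (hT.nonneg i) hne.1.symm)
      (lt_of_le_of_ne (hle i) hne.2)).ne' hi
  have hsum := hT.sum_eq
  rw [Fin.sum_univ_three] at hsum
  have h0 : Real.sin (tropAngle (side P) 0) = 0 := by
    have n0 := hT.nonneg 0
    rcases key 1 h1 with h1 | h1 <;> rcases key 2 h2 with h2 | h2 <;> rw [h1, h2] at hsum
    · rw [show tropAngle (side P) 0 = π by linarith, Real.sin_pi]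
    · rw [show tropAngle (side P) 0 = 0 by linarith, Real.sin_zero]
    · rw [show tropAngle (side P) 0 = 0 by linarith, Real.sin_zero]
    · linarith
  have hall : ∀ i, Real.sin (tropAngle (side P) i) = 0 := by
    intro i; fin_cases i <;> assumption
  -- The middle angle is not `π`, because the largest angle is at least as big and the sum is `π`.
  -- Its vanishing then forces the defect to be one.
  have hmid : tropAngle (side P) (e 1) = 0 := by
    refine (key _ (hall _)).resolve_right fun hp => ?_
    have := hT.sum_eq
    rw [sum_perm e] at this
    linarith [hT.nonneg (e 0), h.tropAngle_mid_le_high]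
  rw [h.tropAngle_mid] at hmid
  have hk : defect (side P) = 1 := by
    have : (1 - defect (side P)) * scale (side P) = 0 := by linarith
    linarith [(mul_eq_zero.1 this).resolve_right h.scale_pos.ne']
  exact im_eq_zero_of_degenerate hP (h.sum_exp_logSide_eq hk)

lemma abs_arg_of_re_pos {z : ℂ} (hi : z.im = 0) (hr : 0 ≤ z.re) : |z.arg| = 0 := by
  rw [Complex.arg_eq_zero_iff.2 ⟨hr, hi⟩, abs_zero]

lemma abs_arg_of_re_neg {z : ℂ} (hi : z.im = 0) (hr : z.re < 0) : |z.arg| = π := by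
  rw [Complex.arg_eq_pi_iff.2 ⟨hr, hi⟩, abs_of_pos Real.pi_pos]

lemma norm_of_im_eq_zero {z : ℂ} (hi : z.im = 0) : ‖z‖ = |z.re| :=
  (Complex.abs_re_eq_norm.2 hi).symm

/-- The isotopy keeps the arguments of real points. -/
lemma turn_of_im_eq_zero {P : Torus} (hP : P ∈ complexLine) (hi : (P.1 : ℂ).im = 0) (t : ℝ) :
    turnFst t P = |(P.1 : ℂ).arg| ∧ turnSnd t P = |(P.2 : ℂ).arg| := by
  have hi2 : (P.2 : ℂ).im = 0 := by rw [im_snd hP, hi, neg_zero]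
  have hre := re_snd hP
  have n1 := norm_of_im_eq_zero hi
  have n2 := norm_of_im_eq_zero hi2
  have r1 : (P.1 : ℂ).re ≠ 0 := fun h => P.1.ne_zero (Complex.ext h hi)
  have r2 : (P.2 : ℂ).re ≠ 0 := fun h => P.2.ne_zero (Complex.ext h hi2)
  -- The signs of the real parts decide which side is the sum of the other two; both positive is
  -- impossible.
  rcases lt_or_gt_of_ne r1 with h1 | h1 <;> rcases lt_or_gt_of_ne r2 with h2 | h2
  · have hA := tropAngle_of_degenerate hP (i := 0) (by
      rw [sum_exp_logSide, exp_logSide, n1, n2, abs_of_neg h1, abs_of_neg h2]; simp; linarith)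
    rw [turnFst, turnSnd, hA, abs_arg_of_re_neg hi h1, abs_arg_of_re_neg hi2 h2]
    simp
    ring
  · have hA := tropAngle_of_degenerate hP (i := 1) (by
      rw [sum_exp_logSide, exp_logSide, n1, n2, abs_of_neg h1, abs_of_pos h2]
      simp [n1, abs_of_neg h1]; linarith)
    rw [turnFst, turnSnd, hA, abs_arg_of_re_neg hi h1, abs_arg_of_re_pos hi2 h2.le]
    simp
    ring
  · have hA := tropAngle_of_degenerate hP (i := 2) (by
      rw [sum_exp_logSide, exp_logSide, n1, n2, abs_of_pos h1, abs_of_neg h2]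
      simp [n2, abs_of_neg h2]; linarith)
    rw [turnFst, turnSnd, hA, abs_arg_of_re_pos hi h1.le, abs_arg_of_re_neg hi2 h2]
    simp
    ring
  · linarith

lemma sin_abs_arg (z : ℂ) : Real.sin |z.arg| = |z.im| / ‖z‖ := by
  rw [← Real.abs_sin_eq_sin_abs_of_abs_le_pi (Complex.abs_arg_le_pi z), Complex.sin_arg, abs_div,
    abs_norm]

lemma point_congr (X : Fin 3 → ℝ) {a b a' b' : ℝ} (ca : Real.cos a = Real.cos a')
    (sa : Real.sin a = Real.sin a') (cb : Real.cos b = Real.cos b')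
    (sb : Real.sin b = Real.sin b') : point X a b = point X a' b' := by
  refine Prod.ext (Units.ext ?_) (Units.ext ?_) <;>
  refine Complex.ext ?_ ?_ <;> simp [point, Complex.exp_re, Complex.exp_im, ca, sa, cb, sb]

/-- At real points both turning angles are `0` or `π`, for which the sign is irrelevant. -/
lemma upperIsotopy_eq_lowerIsotopy {P : Torus} (hP : P ∈ complexLine)
    (hi : (P.1 : ℂ).im = 0) (t : ℝ) : upperIsotopy t P = lowerIsotopy t P := by
  have hi2 : (P.2 : ℂ).im = 0 := by rw [im_snd hP, hi, neg_zero]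
  obtain ⟨h1, h2⟩ := turn_of_im_eq_zero hP hi t
  rw [upperIsotopy, lowerIsotopy, h1, h2]
  apply point_congr <;> simp [sin_abs_arg, hi, hi2]

/-! ### Continuity -/

/-- Unlike `arg`, its absolute value does not jump at the negative real axis. -/
lemma abs_arg_eq_arccos {z : ℂ} (hz : z ≠ 0) : |z.arg| = Real.arccos (z.re / ‖z‖) :=
  (Real.arccos_eq_of_eq_cos (abs_nonneg _) (Complex.abs_arg_le_pi z)
    (by rw [Real.cos_abs, Complex.cos_arg hz])).symm

lemma continuous_abs_arg : Continuous fun u : ℂˣ => |(u : ℂ).arg| := by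
  simp_rw [fun u : ℂˣ => abs_arg_eq_arccos u.ne_zero]
  exact Real.continuous_arccos.comp ((Complex.continuous_re.comp Units.continuous_val).div
    Units.continuous_val.norm fun u => norm_ne_zero_iff.2 u.ne_zero)

lemma continuous_log_norm : Continuous fun u : ℂˣ => Real.log ‖(u : ℂ)‖ :=
  Units.continuous_val.norm.log fun u => norm_ne_zero_iff.2 u.ne_zero

lemma continuous_logSide : Continuous logSide := by
  refine continuous_pi fun i => ?_
  fin_cases i
  · exact continuous_const
  · exact continuous_log_norm.comp continuous_fst
  · exact continuous_log_norm.comp continuous_snd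

lemma continuous_middle : Continuous middle := by
  unfold middle
  refine (Continuous.sub (by fun_prop) ?_).sub ?_
  · exact Continuous.finset_sup'_apply _ fun i _ => continuous_apply i
  · exact Continuous.finset_inf'_apply _ fun i _ => continuous_apply i

lemma continuous_side : Continuous side :=
  continuous_pi fun i => ((continuous_apply i).comp continuous_logSide).sub
    (continuous_middle.comp continuous_logSide)

lemma continuous_depth (i : Fin 3) : Continuous fun x => depth x i := by
  unfold depth; fun_prop

lemma continuous_excess (i : Fin 3) : Continuous fun x => excess x i := by
  unfold excess
  have := continuous_depth
  fun_prop

lemma continuous_defect : Continuous defect :=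
  continuous_finsetSum _ fun i _ => continuous_excess i

lemma continuous_drop (i : Fin 3) : Continuous fun x => drop x i := by
  unfold drop
  have := continuous_depth
  have := continuous_defect
  fun_prop

lemma continuous_tropLength : Continuous tropLength :=
  continuous_pi fun i => (continuous_drop i).sub (continuous_depth i)

/-- Restricted to the line, where `defect ≤ 1` keeps the denominator `3 - defect` of `scale` away
from zero. -/
lemma continuous_tropAngle_side (i : Fin 3) :
    Continuous fun P : complexLine => tropAngle (side P) i := by
  have hs : Continuous fun P : complexLine => side P := continuous_side.comp continuous_subtype_val
  have hd := fun j => (continuous_drop j).comp hs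
  have hk := continuous_defect.comp hs
  have he := (continuous_excess i).comp hs
  have hn : Continuous fun P : complexLine => scale (side P) := by
    unfold scale
    refine Continuous.div ?_ (continuous_const.sub hk) fun P => ?_
    · exact continuous_const.add (continuous_finsetSum _ fun j _ => hd j)
    · linarith [defect_side_le_one P.2]
  exact ((((continuous_const.sub hk).mul hn).div_const 2).add (he.mul hn)).sub
    ((hd i).div_const 2)

lemma continuous_point {Z : Type*} [TopologicalSpace Z] {X : Z → Fin 3 → ℝ} {a b : Z → ℝ}
    (hX : Continuous X) (ha : Continuous a) (hb : Continuous b) :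
    Continuous fun z => point (X z) (a z) (b z) := by
  refine Continuous.prodMk ?_ ?_ <;>
  · rw [Units.isEmbedding_val₀.continuous_iff]
    simp only [Function.comp_def, Units.val_mk0]
    fun_prop

lemma continuous_isotopy :
    Continuous fun p : complexLine × unitInterval => isotopy p.2 p.1 := by
  have hs : Continuous fun p : complexLine × unitInterval => side p.1 :=
    continuous_side.comp (continuous_subtype_val.comp continuous_fst)
  have ht : Continuous fun p : complexLine × unitInterval => (p.2 : ℝ) :=
    continuous_subtype_val.comp continuous_snd
  have hX : Continuous fun p : complexLine × unitInterval => mixLength p.2 (side p.1) := by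
    refine continuous_pi fun i => ?_
    exact ((continuous_const.sub ht).mul ((continuous_apply i).comp hs)).add
      (ht.mul ((continuous_apply i).comp (continuous_tropLength.comp hs)))
  have hA := fun i => (continuous_tropAngle_side i).comp
    (continuous_fst (X := complexLine) (Y := unitInterval))
  have ha : Continuous fun p : complexLine × unitInterval => turnFst p.2 p.1 :=
    ((continuous_const.sub ht).mul (continuous_abs_arg.comp
      (continuous_fst.comp (continuous_subtype_val.comp continuous_fst)))).add
      (ht.mul (continuous_const.sub (hA 2)))
  have hb : Continuous fun p : complexLine × unitInterval => turnSnd p.2 p.1 :=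
    ((continuous_const.sub ht).mul (continuous_abs_arg.comp
      (continuous_snd.comp (continuous_subtype_val.comp continuous_fst)))).add
      (ht.mul (continuous_const.sub (hA 1)))
  have him : Continuous fun p : complexLine × unitInterval => ((p.1 : Torus).1 : ℂ).im :=
    Complex.continuous_im.comp (Units.continuous_val.comp
      (continuous_fst.comp (continuous_subtype_val.comp continuous_fst)))
  unfold isotopy
  exact Continuous.if_le (continuous_point hX ha hb.neg) (continuous_point hX ha.neg hb)
    continuous_const him fun p hp => upperIsotopy_eq_lowerIsotopy p.1.2 hp.symm p.2

lemma point_side_arg (P : Torus) : point (side P) (P.1 : ℂ).arg (P.2 : ℂ).arg = P := by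
  have key : ∀ u : ℂˣ, Complex.exp ((Real.log ‖(u : ℂ)‖ : ℝ) + (u : ℂ).arg * Complex.I) = u :=
    fun u => by
      rw [Complex.exp_add, ← Complex.ofReal_exp, Real.exp_log (norm_pos_iff.2 u.ne_zero),
        Complex.norm_mul_exp_arg_mul_I]
  refine Prod.ext (Units.ext ?_) (Units.ext ?_)
  · simp only [point, Units.val_mk0, side_sub]
    exact key P.1
  · simp only [point, Units.val_mk0, side_sub]
    exact key P.2

lemma isotopy_zero {P : Torus} (hP : P ∈ complexLine) : isotopy 0 P = P := by
  have hX : mixLength 0 (side P) = side P := by ext i; simp [mixLength]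
  have ha : turnFst 0 P = |(P.1 : ℂ).arg| := by simp [turnFst]
  have hb : turnSnd 0 P = |(P.2 : ℂ).arg| := by simp [turnSnd]
  have hi := im_snd hP
  rw [isotopy, upperIsotopy, lowerIsotopy, hX, ha, hb]
  refine Eq.trans ?_ (point_side_arg P)
  split_ifs with h
  · apply point_congr
    · rw [Real.cos_abs]
    · rw [sin_abs_arg, Complex.sin_arg, abs_of_nonneg h]
    · rw [Real.cos_neg, Real.cos_abs]
    · rw [Real.sin_neg, sin_abs_arg, Complex.sin_arg, hi, abs_neg, abs_of_nonneg h, neg_div]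
  · push Not at h
    apply point_congr
    · rw [Real.cos_neg, Real.cos_abs]
    · rw [Real.sin_neg, sin_abs_arg, Complex.sin_arg, abs_of_neg h, neg_div, neg_neg]
    · rw [Real.cos_abs]
    · rw [sin_abs_arg, Complex.sin_arg, hi, abs_neg, abs_of_neg h]

/-! ### Injectivity -/

open Classical in
/-- The sign of the half of the line containing a point. -/
def halfSign (P : Torus) : ℝ := if 0 ≤ (P.1 : ℂ).im then 1 else -1

lemma isotopy_eq (t : ℝ) (P : Torus) : isotopy t P =
    point (mixLength t (side P)) (halfSign P * turnFst t P) (-(halfSign P * turnSnd t P)) := by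
  rw [isotopy, halfSign, upperIsotopy, lowerIsotopy]
  split_ifs <;> simp

lemma norm_point_fst (X : Fin 3 → ℝ) (a b : ℝ) :
    ‖((point X a b).1 : ℂ)‖ = Real.exp (X 1 - X 0) := by
  simp [point, Complex.norm_exp]

lemma norm_point_snd (X : Fin 3 → ℝ) (a b : ℝ) :
    ‖((point X a b).2 : ℂ)‖ = Real.exp (X 2 - X 0) := by
  simp [point, Complex.norm_exp]

lemma point_eq_point {X Y : Fin 3 → ℝ} {a b a' b' : ℝ} (h : point X a b = point Y a' b') :
    (X 1 - X 0 = Y 1 - Y 0 ∧ X 2 - X 0 = Y 2 - Y 0) ∧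
      (Real.cos a = Real.cos a' ∧ Real.sin a = Real.sin a') ∧
      Real.cos b = Real.cos b' ∧ Real.sin b = Real.sin b' := by
  have h1 : X 1 - X 0 = Y 1 - Y 0 := by
    have := norm_point_fst X a b
    rw [h, norm_point_fst] at this
    exact (Real.exp_injective this).symm
  have h2 : X 2 - X 0 = Y 2 - Y 0 := by
    have := norm_point_snd X a b
    rw [h, norm_point_snd] at this
    exact (Real.exp_injective this).symm
  have e1 : Complex.exp ((X 1 - X 0 : ℝ) + a * Complex.I)
      = Complex.exp ((Y 1 - Y 0 : ℝ) + a' * Complex.I) :=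
    congrArg (fun P : Torus => (P.1 : ℂ)) h
  have e2 : Complex.exp ((X 2 - X 0 : ℝ) + b * Complex.I)
      = Complex.exp ((Y 2 - Y 0 : ℝ) + b' * Complex.I) :=
    congrArg (fun P : Torus => (P.2 : ℂ)) h
  have key : ∀ {x u v : ℝ}, Complex.exp ((x : ℝ) + u * Complex.I)
      = Complex.exp ((x : ℝ) + v * Complex.I) → Real.cos u = Real.cos v ∧ Real.sin u = Real.sin v := by
    intro x u v huv
    rw [Complex.exp_add, Complex.exp_add] at huv
    have := mul_left_cancel₀ (Complex.exp_ne_zero _) huv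
    constructor
    · simpa [Complex.exp_re] using congrArg Complex.re this
    · simpa [Complex.exp_im] using congrArg Complex.im this
  rw [← h1] at e1
  rw [← h2] at e2
  exact ⟨⟨h1, h2⟩, key e1, key e2⟩

lemma Arranged.middle_mixLength {e : Equiv.Perm (Fin 3)} {s r : ℝ} {x : Fin 3 → ℝ}
    (h : Arranged e s r x) {t : ℝ} (h0 : 0 ≤ t) (h1 : t ≤ 1) :
    mixLength t x (e 1) = 0 ∧ middle (mixLength t x) = 0 := by
  have m1 : mixLength t x (e 1) = 0 := by
    rw [mixLength, h.mid, h.tropLength_mid]; ring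
  refine ⟨m1, ?_⟩
  rw [middle_eq e, m1]
  · rw [m1, mixLength, h.low]
    nlinarith [h.s_nonneg, tropLength_nonpos x (e 0)]
  · rw [m1, mixLength, h.high, h.tropLength_high, mul_zero, add_zero]
    exact mul_nonneg (by linarith) h.r_nonneg

lemma tropAngle_side_mem {P : Torus} (hP : P ∈ complexLine) (i : Fin 3) :
    tropAngle (side P) i ∈ Set.Icc 0 π := by
  obtain ⟨e, s, r, h⟩ := exists_arranged_side hP
  have hT := h.tropData
  refine ⟨hT.nonneg i, ?_⟩
  rw [← hT.sum_eq]
  exact Finset.single_le_sum (fun j _ => hT.nonneg j) (Finset.mem_univ i)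

lemma abs_arg_eq_of_norm_eq {z w : ℂ} (hz : z ≠ 0) (hw : w ≠ 0) (hn : ‖z‖ = ‖w‖)
    (hr : z.re = w.re) : |z.arg| = |w.arg| := by
  rw [abs_arg_eq_arccos hz, abs_arg_eq_arccos hw, hn, hr]

lemma halfSign_eq (P : Torus) : halfSign P = 1 ∨ halfSign P = -1 := by
  rw [halfSign]; split_ifs <;> simp

lemma cos_halfSign_mul (P : Torus) (a : ℝ) : Real.cos (halfSign P * a) = Real.cos a := by
  rcases halfSign_eq P with h | h <;> simp [h]

lemma turn_mem {P : Torus} (hP : P ∈ complexLine) {t : ℝ} (ht : t ∈ Set.Icc (0 : ℝ) 1) :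
    turnFst t P ∈ Set.Icc 0 π ∧ turnSnd t P ∈ Set.Icc 0 π := by
  have key : ∀ a ∈ Set.Icc 0 π, ∀ b ∈ Set.Icc 0 π, (1 - t) * a + t * (π - b) ∈ Set.Icc 0 π := by
    intro a ha b hb
    have h1 := ht.1
    have h2 := ht.2
    have h3 := ha.1
    have h4 := ha.2
    have h5 := hb.1
    have h6 := hb.2
    constructor <;> nlinarith
  exact ⟨key _ ⟨abs_nonneg _, Complex.abs_arg_le_pi _⟩ _ (tropAngle_side_mem hP 2),
    key _ ⟨abs_nonneg _, Complex.abs_arg_le_pi _⟩ _ (tropAngle_side_mem hP 1)⟩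

/-- During the isotopy, only real points have real images. -/
lemma im_eq_zero_of_sin_turn {P : Torus} (hP : P ∈ complexLine) {t : ℝ}
    (ht : t ∈ Set.Icc (0 : ℝ) 1) (h1 : Real.sin (turnFst t P) = 0)
    (h2 : Real.sin (turnSnd t P) = 0) : (P.1 : ℂ).im = 0 := by
  -- For `t < 1` a nonreal `z₁` has `|arg|` strictly between `0` and `π`, and so has its combination
  -- with an angle in `[0, π]`. At `t = 1` the tropical angles must form a vertex of the triangle of
  -- angles.
  rcases ht.2.lt_or_eq with hlt | rfl
  · by_contra him
    have hpos : 0 < Real.sin |(P.1 : ℂ).arg| := by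
      rw [sin_abs_arg]
      exact div_pos (abs_pos.2 him) (norm_pos_iff.2 P.1.ne_zero)
    have ha0 : 0 < |(P.1 : ℂ).arg| := lt_of_le_of_ne (abs_nonneg _) fun h => by
      rw [← h, Real.sin_zero] at hpos; exact lt_irrefl _ hpos
    have ha1 : |(P.1 : ℂ).arg| < π := lt_of_le_of_ne (Complex.abs_arg_le_pi _) fun h => by
      rw [h, Real.sin_pi] at hpos; exact lt_irrefl _ hpos
    have hA := tropAngle_side_mem hP 2
    refine (Real.sin_pos_of_pos_of_lt_pi ?_ ?_).ne' h1
    · have := mul_nonneg ht.1 (sub_nonneg.2 hA.2)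
      have := mul_pos (sub_pos.2 hlt) ha0
      rw [turnFst]; linarith
    · have := mul_nonneg ht.1 hA.1
      have := mul_pos (sub_pos.2 hlt) (sub_pos.2 ha1)
      rw [turnFst]; linarith
  · apply im_eq_zero_of_sin_tropAngle hP
    · simpa [turnSnd] using h2
    · simpa [turnFst] using h1

lemma side_eq_of_isotopy_eq {P Q : Torus} (hP : P ∈ complexLine) (hQ : Q ∈ complexLine) {t : ℝ}
    (ht : t ∈ Set.Icc (0 : ℝ) 1) (h : isotopy t P = isotopy t Q) : side P = side Q := by
  rw [isotopy_eq, isotopy_eq] at h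
  obtain ⟨⟨h1, h2⟩, ⟨ca, -⟩, cb, -⟩ := point_eq_point h
  obtain ⟨e, s, r, hp⟩ := exists_arranged_side hP
  obtain ⟨e', s', r', hq⟩ := exists_arranged_side hQ
  have hX := eq_of_sub_eq (hp.middle_mixLength ht.1 ht.2).2 (hq.middle_mixLength ht.1 ht.2).2 h1 h2
  -- Before the end the lengths suffice; at the end the angles are recovered from cosines, which do
  -- not see the half.
  rcases ht.2.lt_or_eq with hlt | rfl
  · exact mixLength_injective hp.defect_le_one hq.defect_le_one ht.1 hlt hX
  · rw [cos_halfSign_mul, cos_halfSign_mul] at ca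
    rw [Real.cos_neg, Real.cos_neg, cos_halfSign_mul, cos_halfSign_mul] at cb
    have ha := Real.injOn_cos (turn_mem hP ht).1 (turn_mem hQ ht).1 ca
    have hb := Real.injOn_cos (turn_mem hP ht).2 (turn_mem hQ ht).2 cb
    have h2 : tropAngle (side P) 2 = tropAngle (side Q) 2 := by
      simp only [turnFst] at ha; linarith
    have h1 : tropAngle (side P) 1 = tropAngle (side Q) 1 := by
      simp only [turnSnd] at hb; linarith
    have h0 : tropAngle (side P) 0 = tropAngle (side Q) 0 := by
      have e1 := hp.tropData.sum_eq
      have e2 := hq.tropData.sum_eq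
      rw [Fin.sum_univ_three] at e1 e2
      linarith
    refine hp.eq_of_tropical_eq hq ?_ (funext fun i => by fin_cases i <;> assumption)
    ext i
    have := congrFun hX i
    simpa [mixLength] using this

lemma eq_of_re_eq_of_im_eq {P Q : Torus} (hP : P ∈ complexLine) (hQ : Q ∈ complexLine)
    (hr : (P.1 : ℂ).re = (Q.1 : ℂ).re) (hi : (P.1 : ℂ).im = (Q.1 : ℂ).im) : P = Q := by
  have h1 : (P.1 : ℂ) = Q.1 := Complex.ext hr hi
  exact Prod.ext (Units.ext h1) (Units.ext (by rw [snd_eq hP, snd_eq hQ, h1]))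

lemma re_eq_and_sq_im_eq {P Q : Torus} (hP : P ∈ complexLine) (hQ : Q ∈ complexLine)
    (h : side P = side Q) :
    (P.1 : ℂ).re = (Q.1 : ℂ).re ∧ (P.1 : ℂ).im ^ 2 = (Q.1 : ℂ).im ^ 2 := by
  obtain ⟨n1, n2⟩ := norm_eq_of_side_eq h
  have p1 := norm_fst_sq P
  have p2 := norm_snd_sq hP
  have q1 := norm_fst_sq Q
  have q2 := norm_snd_sq hQ
  rw [n1] at p1
  rw [n2] at p2
  have hr : (P.1 : ℂ).re = (Q.1 : ℂ).re := by linarith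
  rw [hr] at p1
  exact ⟨hr, by linarith⟩

/-- Equal sides leave only `P = Q` or complex conjugates; in the latter case opposite signs give the
same image, so the sines vanish and the points are real. -/
lemma isotopy_injOn {t : ℝ} (ht : t ∈ Set.Icc (0 : ℝ) 1) : Set.InjOn (isotopy t) complexLine := by
  intro P hP Q hQ h
  have hside := side_eq_of_isotopy_eq hP hQ ht h
  obtain ⟨hr, hsq⟩ := re_eq_and_sq_im_eq hP hQ hside
  by_cases hi : (P.1 : ℂ).im = (Q.1 : ℂ).im
  · exact eq_of_re_eq_of_im_eq hP hQ hr hi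
  exfalso
  have hneg : (P.1 : ℂ).im = -(Q.1 : ℂ).im := (sq_eq_sq_iff_eq_or_eq_neg.1 hsq).resolve_left hi
  obtain ⟨n1, n2⟩ := norm_eq_of_side_eq hside
  have ha : turnFst t P = turnFst t Q := by
    rw [turnFst, turnFst, hside, abs_arg_eq_of_norm_eq P.1.ne_zero Q.1.ne_zero n1 hr]
  have hb : turnSnd t P = turnSnd t Q := by
    rw [turnSnd, turnSnd, hside, abs_arg_eq_of_norm_eq P.2.ne_zero Q.2.ne_zero n2
      (by rw [re_snd hP, re_snd hQ, hr])]
  have hsign : halfSign P = -halfSign Q := by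
    rw [halfSign, halfSign]
    split_ifs with h1 h2 h2
    · exact absurd (by linarith) hi
    · rw [neg_neg]
    · rfl
    · linarith
  rw [isotopy_eq, isotopy_eq, ha, hb, hsign] at h
  obtain ⟨-, ⟨-, sa⟩, -, sb⟩ := point_eq_point h
  have hQ0 : (Q.1 : ℂ).im = 0 := by
    rcases halfSign_eq Q with hs | hs <;> rw [hs] at sa sb <;> simp at sa sb <;>
      exact im_eq_zero_of_sin_turn hQ ht (by linarith) (by linarith)
  rw [hQ0, neg_zero] at hneg
  exact hi (hneg.trans hQ0.symm)

/-! ### Properness -/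

lemma isCompact_log_norm_le (R : ℝ) : IsCompact {u : ℂˣ | |Real.log ‖(u : ℂ)‖| ≤ R} := by
  rw [Units.isEmbedding_val₀.isCompact_iff]
  have himg : Units.val '' {u : ℂˣ | |Real.log ‖(u : ℂ)‖| ≤ R}
      = {z : ℂ | Real.exp (-R) ≤ ‖z‖} ∩ Metric.closedBall 0 (Real.exp R) := by
    ext z
    constructor
    · rintro ⟨u, hu, rfl⟩
      have hpos := norm_pos_iff.2 u.ne_zero
      have hu' := abs_le.1 (show |Real.log ‖(u : ℂ)‖| ≤ R from hu)
      exact ⟨(Real.le_log_iff_exp_le hpos).1 hu'.1,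
        mem_closedBall_zero_iff.2 ((Real.log_le_iff_le_exp hpos).1 hu'.2)⟩
    · rintro ⟨h1, h2⟩
      have hpos : 0 < ‖z‖ := (Real.exp_pos _).trans_le h1
      refine ⟨Units.mk0 z (norm_pos_iff.1 hpos), ?_, rfl⟩
      refine Set.mem_ofPred_eq ▸ abs_le.2 ⟨?_, ?_⟩
      · exact (Real.le_log_iff_exp_le hpos).2 h1
      · exact (Real.log_le_iff_le_exp hpos).2 (mem_closedBall_zero_iff.1 h2)
  rw [himg]
  exact (isCompact_closedBall _ _).inter_left (isClosed_le continuous_const continuous_norm)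

lemma isClosed_complexLine : IsClosed complexLine := by
  refine isClosed_eq ?_ continuous_const
  exact (continuous_const.add (Units.continuous_val.comp continuous_fst)).add
    (Units.continuous_val.comp continuous_snd)

/-- Of the bound, `2 * C` controls the interpolated length, `π` the drop on negative sides, and `1`
the positive side, since `exp r - 1 ≤ 1`. -/
lemma abs_side_le {P : Torus} (hP : P ∈ complexLine) {t C : ℝ} (ht : t ∈ Set.Icc (0 : ℝ) 1)
    (h1 : |Real.log ‖((isotopy t P).1 : ℂ)‖| ≤ C) (h2 : |Real.log ‖((isotopy t P).2 : ℂ)‖| ≤ C)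
    (i : Fin 3) : |side P i| ≤ 2 * C + π + 1 := by
  rw [isotopy_eq, norm_point_fst, Real.log_exp] at h1
  rw [isotopy_eq, norm_point_snd, Real.log_exp] at h2
  obtain ⟨e, s, r, h⟩ := exists_arranged_side hP
  have hC : 0 ≤ C := (abs_nonneg _).trans h1
  set X := mixLength t (side P) with hX
  have hd : ∀ j, |X j - X 0| ≤ C := by
    intro j
    fin_cases j
    · simpa using hC
    · exact h1
    · exact h2
  have hXi : |X i| ≤ 2 * C := by
    have a := abs_le.1 (hd i)
    -- The middle coordinate is zero, which bounds `X 0` itself by `C`.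
    have b := abs_le.1 (hd (e 1))
    rw [hX, (h.middle_mixLength ht.1 ht.2).1, ← hX] at b
    rw [abs_le]
    constructor <;> linarith
  have hpi := Real.pi_pos
  rcases le_total 0 (side P i) with hi | hi
  · rw [abs_of_nonneg hi]
    have hr : r ≤ 1 := by
      have e1 := h.triangle
      have e2 : Real.exp (-s) ≤ 1 := Real.exp_le_one_iff.2 (by linarith [h.s_nonneg])
      have e3 := Real.add_one_le_exp r
      linarith
    have : side P i ≤ r := forall_perm e (p := fun i => side P i ≤ r)
      (by rw [h.low]; linarith [h.s_nonneg, h.r_nonneg]) (by rw [h.mid]; exact h.r_nonneg)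
      h.high.le i
    linarith
  · rw [abs_of_nonpos hi, ← depth_eq_neg hi]
    have e1 : X i = -depth (side P) i + t * drop (side P) i := by
      rw [hX, mixLength, tropLength, show side P i = -depth (side P) i by
        rw [depth_eq_neg hi, neg_neg]]
      ring
    have e2 := drop_le_pi (side P) i
    have e3 := drop_nonneg h.defect_le_one i
    have e4 := (abs_le.1 hXi).1
    nlinarith [ht.1, ht.2]

lemma isCompact_preimage_isotopy {t : ℝ} (ht : t ∈ Set.Icc (0 : ℝ) 1)
    (hc : Continuous fun P : complexLine => isotopy t P) {K : Set Torus} (hK : IsCompact K) :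
    IsCompact ((fun P : complexLine => isotopy t P) ⁻¹' K) := by
  obtain ⟨C₁, hC₁⟩ := (hK.image (continuous_log_norm.comp continuous_fst)).isBounded.exists_norm_le
  obtain ⟨C₂, hC₂⟩ := (hK.image (continuous_log_norm.comp continuous_snd)).isBounded.exists_norm_le
  -- The factor two comes from `logSide P i = side P i - side P 0`.
  set R := 2 * (2 * max C₁ C₂ + π + 1) with hR
  have hB : IsCompact ({u : ℂˣ | |Real.log ‖(u : ℂ)‖| ≤ R} ×ˢ {u : ℂˣ | |Real.log ‖(u : ℂ)‖| ≤ R}) :=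
    (isCompact_log_norm_le R).prod (isCompact_log_norm_le R)
  refine (isClosed_complexLine.isClosedEmbedding_subtypeVal.isCompact_preimage hB).of_isClosed_subset
    (hK.isClosed.preimage hc) fun P hPK => ?_
  have h := abs_side_le P.2 ht ((hC₁ _ ⟨_, hPK, rfl⟩).trans (le_max_left C₁ C₂))
    ((hC₂ _ ⟨_, hPK, rfl⟩).trans (le_max_right C₁ C₂))
  have key : ∀ i, |logSide P i| ≤ R := fun i => by
    rw [← side_sub]
    exact (abs_sub _ _).trans (by linarith [h i, h 0])
  exact ⟨key 1, key 2⟩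

lemma continuous_isotopy_apply {t : ℝ} (ht : t ∈ Set.Icc (0 : ℝ) 1) :
    Continuous fun P : complexLine => isotopy t P :=
  continuous_isotopy.comp (continuous_id.prodMk (continuous_const (y := (⟨t, ht⟩ : unitInterval))))

lemma isClosedEmbedding_isotopy {t : ℝ} (ht : t ∈ Set.Icc (0 : ℝ) 1) :
    IsClosedEmbedding fun P : complexLine => isotopy t P := by
  have hc := continuous_isotopy_apply ht
  have hp : IsProperMap fun P : complexLine => isotopy t P :=
    isProperMap_iff_isCompact_preimage.2 ⟨hc, fun K hK => isCompact_preimage_isotopy ht hc hK⟩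
  exact .of_continuous_injective_isClosedMap hc
    (fun P Q h => Subtype.ext (isotopy_injOn ht P.2 Q.2 h)) hp.isClosedMap

/-! ### The image at the end of the isotopy -/

/-- The two halves of the tropical line, described by lengths and angles. -/
def tropicalSet : Set Torus :=
  {w | ∃ X α, TropData X α ∧ ∃ ε : ℝ, (ε = 1 ∨ ε = -1) ∧
    w = point X (ε * (π - α 2)) (-(ε * (π - α 1)))}

lemma isotopy_one (P : Torus) : isotopy 1 P = point (tropLength (side P))
    (halfSign P * (π - tropAngle (side P) 2)) (-(halfSign P * (π - tropAngle (side P) 1))) := by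
  have hX : mixLength 1 (side P) = tropLength (side P) := by ext i; simp [mixLength]
  rw [isotopy_eq, hX, turnFst, turnSnd]
  simp

/-- Every triangle shape is realized on the line, in either half. -/
lemma exists_side_eq {e : Equiv.Perm (Fin 3)} {s r : ℝ} {x : Fin 3 → ℝ} (h : Arranged e s r x)
    {ε : ℝ} (hε : ε = 1 ∨ ε = -1) :
    ∃ P ∈ complexLine, side P = x ∧ (halfSign P = ε ∨ (P.1 : ℂ).im = 0) := by
  have htri : ∀ i, 2 * Real.exp (x i) ≤ ∑ j, Real.exp (x j) := by
    rw [sum_perm e, h.low, h.mid, h.high, Real.exp_zero]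
    have h1 := h.triangle
    have h2 : Real.exp (-s) ≤ 1 := Real.exp_le_one_iff.2 (by linarith [h.s_nonneg])
    have h3 : 1 ≤ Real.exp r := Real.one_le_exp h.r_nonneg
    have h4 := Real.exp_pos (-s)
    refine forall_perm e ?_ ?_ ?_
    · rw [h.low]; linarith
    · rw [h.mid, Real.exp_zero]; linarith
    · rw [h.high]; linarith
  set a := Real.exp (x 1 - x 0) with ha
  set b := Real.exp (x 2 - x 0) with hb
  have ha0 : 0 < a := Real.exp_pos _
  have hb0 : 0 < b := Real.exp_pos _
  have hx1 : Real.exp (x 1) = Real.exp (x 0) * a := by rw [ha, ← Real.exp_add]; congr 1; ring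
  have hx2 : Real.exp (x 2) = Real.exp (x 0) * b := by rw [hb, ← Real.exp_add]; congr 1; ring
  rw [Fin.sum_univ_three, hx1, hx2] at htri
  have hpos := Real.exp_pos (x 0)
  have t0 : 1 ≤ a + b := by
    have := htri 0
    exact le_of_mul_le_mul_left (by linarith) hpos
  have t1 : a ≤ 1 + b := by
    have := htri 1
    rw [hx1] at this
    exact le_of_mul_le_mul_left (by linarith) hpos
  have t2 : b ≤ 1 + a := by
    have := htri 2
    rw [hx2] at this
    exact le_of_mul_le_mul_left (by linarith) hpos
  -- Law of cosines: the real part for which `‖z‖ = a` and `‖-1 - z‖ = b`; the height `v` is real by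
  -- Heron's formula.
  set u := (b ^ 2 - a ^ 2 - 1) / 2 with hu
  have hdisc : 0 ≤ a ^ 2 - u ^ 2 := by
    have : 4 * (a ^ 2 - u ^ 2) = (1 + a + b) * (a + b - 1) * ((1 + b - a) * (1 + a - b)) := by
      rw [hu]; ring
    have h1 : 0 ≤ (1 + a + b) * (a + b - 1) := mul_nonneg (by linarith) (by linarith)
    have h2 : 0 ≤ (1 + b - a) * (1 + a - b) := mul_nonneg (by linarith) (by linarith)
    have := mul_nonneg h1 h2
    linarith
  set v := Real.sqrt (a ^ 2 - u ^ 2) with hv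
  have hv0 : 0 ≤ v := Real.sqrt_nonneg _
  have hv2 : v ^ 2 = a ^ 2 - u ^ 2 := Real.sq_sqrt hdisc
  have hε2 : ε ^ 2 = 1 := by rcases hε with rfl | rfl <;> norm_num
  let z : ℂ := ⟨u, ε * v⟩
  have hz : ‖z‖ = a := by
    rw [← sq_eq_sq₀ (norm_nonneg _) ha0.le, Complex.sq_norm, Complex.normSq_apply]
    change u * u + ε * v * (ε * v) = a ^ 2
    linear_combination v ^ 2 * hε2 + hv2
  have hz' : ‖-1 - z‖ = b := by
    rw [← sq_eq_sq₀ (norm_nonneg _) hb0.le, Complex.sq_norm, Complex.normSq_apply]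
    simp only [Complex.sub_re, Complex.neg_re, Complex.one_re, Complex.sub_im, Complex.neg_im,
      Complex.one_im, z]
    rw [hu] at hv2 ⊢
    linear_combination v ^ 2 * hε2 + hv2
  have hz0 : z ≠ 0 := norm_pos_iff.1 (hz ▸ ha0)
  have hz0' : -1 - z ≠ 0 := norm_pos_iff.1 (hz' ▸ hb0)
  let P : Torus := (Units.mk0 z hz0, Units.mk0 (-1 - z) hz0')
  have hP : P ∈ complexLine := by
    change 1 + z + (-1 - z) = 0
    ring
  have hxm : middle x = 0 := by
    rw [middle_eq e, h.mid]
    · rw [h.low, h.mid]; linarith [h.s_nonneg]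
    · rw [h.mid, h.high]; exact h.r_nonneg
  refine ⟨P, hP, eq_of_sub_eq (middle_side P) hxm ?_ ?_, ?_⟩
  · rw [side_sub]
    change Real.log ‖z‖ = _
    rw [hz, Real.log_exp]
  · rw [side_sub]
    change Real.log ‖-1 - z‖ = _
    rw [hz', Real.log_exp]
  · change halfSign P = ε ∨ ε * v = 0
    by_cases hv' : v = 0
    · exact Or.inr (by rw [hv', mul_zero])
    · left
      have hvpos := lt_of_le_of_ne hv0 (Ne.symm hv')
      rw [halfSign]
      change (if 0 ≤ ε * v then (1 : ℝ) else -1) = ε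
      rcases hε with rfl | rfl
      · rw [if_pos (by linarith)]
      · rw [if_neg (by linarith)]

lemma range_isotopy_one : Set.range (fun P : complexLine => isotopy 1 P) = tropicalSet := by
  ext w
  constructor
  · rintro ⟨P, rfl⟩
    obtain ⟨e, s, r, h⟩ := exists_arranged_side P.2
    exact ⟨_, _, h.tropData, _, halfSign_eq P, isotopy_one P⟩
  · rintro ⟨X, α, hT, ε, hε, rfl⟩
    obtain ⟨e, s, r, x, hx, rfl, rfl⟩ := hT.exists_arranged
    obtain ⟨P, hP, rfl, hs⟩ := exists_side_eq hx hε
    refine ⟨⟨P, hP⟩, (isotopy_one P).trans ?_⟩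
    rcases hs with hs | hi
    · rw [hs]
    -- For a real point the half is ambiguous, but the sines vanish, so either sign gives the same
    -- point.
    · have hi2 : (P.2 : ℂ).im = 0 := by rw [im_snd hP, hi, neg_zero]
      obtain ⟨h1, h2⟩ := turn_of_im_eq_zero hP hi 1
      have s1 : Real.sin (π - tropAngle (side P) 2) = 0 := by
        have : turnFst 1 P = π - tropAngle (side P) 2 := by simp [turnFst]
        rw [← this, h1, sin_abs_arg, hi, abs_zero, zero_div]
      have s2 : Real.sin (π - tropAngle (side P) 1) = 0 := by
        have : turnSnd 1 P = π - tropAngle (side P) 1 := by simp [turnSnd]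
        rw [← this, h2, sin_abs_arg, hi2, abs_zero, zero_div]
      rcases halfSign_eq P with h | h <;> rcases hε with rfl | rfl <;> rw [h] <;>
        apply point_congr <;>
        simp only [one_mul, neg_mul, neg_neg, Real.cos_neg, Real.sin_neg, s1, s2, neg_zero]

lemma isClosed_tropicalSet : IsClosed tropicalSet := by
  rw [← range_isotopy_one]
  exact (isClosedEmbedding_isotopy ⟨zero_le_one, le_rfl⟩).isClosed_range

/-! ### The phase tropical line -/

lemma order_eq_of_coeff {z : PuiseuxReal} {g : ℝ} (hg : z.coeff g ≠ 0)
    (hlt : ∀ j < g, z.coeff j = 0) : z.order = g ∧ z.leadingCoeff = z.coeff g := by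
  have h : z.order = g := by
    refine le_antisymm (HahnSeries.order_le_of_coeff_ne_zero hg) (le_of_not_gt fun hj => ?_)
    have hz : z ≠ 0 := fun h => hg (by rw [h]; rfl)
    exact hz (HahnSeries.coeff_order_eq_zero.1 (hlt _ hj))
  exact ⟨h, by rw [HahnSeries.leadingCoeff_eq, h]⟩

lemma coeff_one_zero : (1 : PuiseuxReal).coeff 0 = 1 := by simp

lemma coeff_one_of_ne {j : ℝ} (hj : j ≠ 0) : (1 : PuiseuxReal).coeff j = 0 := by
  simp [HahnSeries.coeff_one, hj]

lemma val₂_eq {p : PuiseuxRealˣ × PuiseuxRealˣ} {X : Fin 3 → ℝ}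
    (h1 : X 1 - X 0 = -(p.1 : PuiseuxReal).order) (h2 : X 2 - X 0 = -(p.2 : PuiseuxReal).order) :
    val₂ p = point X (p.1 : PuiseuxReal).leadingCoeff.arg
      (p.2 : PuiseuxReal).leadingCoeff.arg := by
  refine Prod.ext (Units.ext ?_) (Units.ext ?_)
  · simp only [val₂, val, point, Units.val_mk0]
    rw [h1, mul_comm Complex.I]; push_cast; rfl
  · simp only [val₂, val, point, Units.val_mk0]
    rw [h2, mul_comm Complex.I]; push_cast; rfl

lemma cos_sign_mul {ε : ℝ} (hε : ε = 1 ∨ ε = -1) (a : ℝ) : Real.cos (ε * a) = Real.cos a := by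
  rcases hε with rfl | rfl <;> simp

lemma sin_sign_mul {ε : ℝ} (hε : ε = 1 ∨ ε = -1) (a : ℝ) : Real.sin (ε * a) = ε * Real.sin a := by
  rcases hε with rfl | rfl <;> simp

lemma exists_sign (y : ℝ) : ∃ ε : ℝ, (ε = 1 ∨ ε = -1) ∧ ε * |y| = y := by
  rcases le_total 0 y with h | h
  · exact ⟨1, Or.inl rfl, by rw [abs_of_nonneg h, one_mul]⟩
  · exact ⟨-1, Or.inr rfl, by rw [abs_of_nonpos h]; ring⟩

lemma sin_sign_abs_arg {ε : ℝ} (hε : ε = 1 ∨ ε = -1) {c : ℂ} (h : ε * |c.im| = c.im) :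
    Real.sin c.arg = Real.sin (ε * |c.arg|) := by
  rw [sin_sign_mul hε, sin_abs_arg, Complex.sin_arg, ← mul_div_assoc, h]

lemma point_mem_tropicalSet {X α : Fin 3 → ℝ} (hT : TropData X α) {ε : ℝ}
    (hε : ε = 1 ∨ ε = -1) {a b : ℝ} (ca : Real.cos a = Real.cos (π - α 2))
    (sa : Real.sin a = ε * Real.sin (π - α 2)) (cb : Real.cos b = Real.cos (π - α 1))
    (sb : Real.sin b = -(ε * Real.sin (π - α 1))) : point X a b ∈ tropicalSet := by
  refine ⟨X, α, hT, ε, hε, point_congr X ?_ ?_ ?_ ?_⟩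
  · rw [ca, cos_sign_mul hε]
  · rw [sa, sin_sign_mul hε]
  · rw [cb, Real.cos_neg, cos_sign_mul hε]
  · rw [sb, Real.sin_neg, sin_sign_mul hε]

/-- The two exterior angles of a triangle add up to at least `π`. -/
lemma pi_le_abs_arg_add_abs_arg {c d : ℂ} (hc : c ≠ 0) (hd : d ≠ 0) (h : 1 + c + d = 0) :
    π ≤ |c.arg| + |d.arg| := by
  by_contra! hlt
  have hre : 1 + c.re + d.re = 0 := by simpa using congrArg Complex.re h
  have him : c.im + d.im = 0 := by simpa using congrArg Complex.im h
  have hc' := norm_pos_iff.2 hc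
  have hd' := norm_pos_iff.2 hd
  -- This sine equals `-|im c| / (‖c‖ * ‖d‖)`, whereas a sum strictly between `0` and `π` has
  -- positive sine. A zero sum would make `c` and `d` nonnegative reals.
  have hsin : Real.sin (|c.arg| + |d.arg|) ≤ 0 := by
    rw [Real.sin_add, sin_abs_arg, sin_abs_arg, Real.cos_abs, Real.cos_abs, Complex.cos_arg hc,
      Complex.cos_arg hd, show d.im = -c.im by linarith, abs_neg,
      show d.re = -1 - c.re by linarith]
    have : |c.im| / ‖c‖ * ((-1 - c.re) / ‖d‖) + c.re / ‖c‖ * (|c.im| / ‖d‖)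
        = -(|c.im| / (‖c‖ * ‖d‖)) := by field_simp; ring
    rw [this]
    exact neg_nonpos.2 (by positivity)
  have hc0 := abs_nonneg c.arg
  have hd0 := abs_nonneg d.arg
  have hsum : |c.arg| + |d.arg| = 0 := by
    by_contra hne
    exact hsin.not_gt (Real.sin_pos_of_pos_of_lt_pi
      (lt_of_le_of_ne (add_nonneg hc0 hd0) (Ne.symm hne)) hlt)
  have hc1 : c.arg = 0 := abs_eq_zero.1 (by linarith)
  have hd1 : d.arg = 0 := abs_eq_zero.1 (by linarith)
  linarith [(Complex.arg_eq_zero_iff.1 hc1).1, (Complex.arg_eq_zero_iff.1 hd1).1]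

/-- The half-strip over the edge of the triangle of angles opposite to the vertex `i`. -/
lemma tropData_single {i j k : Fin 3} (hij : i ≠ j) (hik : i ≠ k) {x a : ℝ}
    (hx : x ≤ 0) (h0 : 0 ≤ a) (h1 : a ≤ π) :
    TropData (Pi.single i x) (Pi.single j a + Pi.single k (π - a)) where
  nonpos l := by
    by_cases h : l = i
    · subst h; simpa using hx
    · simp [h]
  nonneg l := by
    have : ∀ (m : Fin 3) (y : ℝ), 0 ≤ y → 0 ≤ (Pi.single m y : Fin 3 → ℝ) l := fun m y hy => by
      by_cases h : l = m
      · subst h; simpa using hy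
      · simp [h]
    exact add_nonneg (this j a h0) (this k _ (by linarith))
  sum_eq := by simp [Finset.sum_add_distrib]
  angle_eq_zero l hl := by
    by_cases h : l = i
    · subst h; simp [hij, hik]
    · simp [h] at hl
  eq_zero_or l m hlm := by
    by_cases h : l = i
    · subst h; right; simp [hlm.symm]
    · left; simp [h]

lemma tropData_zero {α : Fin 3 → ℝ} (h0 : ∀ i, 0 ≤ α i) (hs : ∑ i, α i = π) :
    TropData 0 α where
  nonpos _ := le_rfl
  nonneg := h0
  sum_eq := hs
  angle_eq_zero _ h := absurd h (lt_irrefl _)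
  eq_zero_or _ _ _ := Or.inl rfl

/-- The least order among `1`, `z`, `w` is attained at least twice. If exactly twice, those leading
terms cancel and the third is free: a half-strip. If three times, the leading coefficients form a
complex triangle. -/
lemma val₂_mem_tropicalSet {p : PuiseuxRealˣ × PuiseuxRealˣ} (hp : p ∈ puiseuxLine) :
    val₂ p ∈ tropicalSet := by
  have hp' : 1 + (p.1 : PuiseuxReal) + (p.2 : PuiseuxReal) = 0 := hp
  have hcoeff : ∀ j, (1 : PuiseuxReal).coeff j + (p.1 : PuiseuxReal).coeff j
      + (p.2 : PuiseuxReal).coeff j = 0 := fun j => congrArg (fun z => HahnSeries.coeff z j) hp'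
  have hl1 : (p.1 : PuiseuxReal).leadingCoeff ≠ 0 :=
    HahnSeries.leadingCoeff_ne_zero.2 p.1.ne_zero
  have hl2 : (p.2 : PuiseuxReal).leadingCoeff ≠ 0 :=
    HahnSeries.leadingCoeff_ne_zero.2 p.2.ne_zero
  have c1 := HahnSeries.leadingCoeff_eq (x := (p.1 : PuiseuxReal))
  have c2 := HahnSeries.leadingCoeff_eq (x := (p.2 : PuiseuxReal))
  have lt1 : ∀ j < (p.1 : PuiseuxReal).order, (p.1 : PuiseuxReal).coeff j = 0 :=
    fun j hj => HahnSeries.coeff_eq_zero_of_lt_order hj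
  have lt2 : ∀ j < (p.2 : PuiseuxReal).order, (p.2 : PuiseuxReal).coeff j = 0 :=
    fun j hj => HahnSeries.coeff_eq_zero_of_lt_order hj
  set z := (p.1 : PuiseuxReal)
  set w := (p.2 : PuiseuxReal)
  have harg1 : |z.leadingCoeff.arg| ∈ Set.Icc 0 π := ⟨abs_nonneg _, Complex.abs_arg_le_pi _⟩
  have harg2 : |w.leadingCoeff.arg| ∈ Set.Icc 0 π := ⟨abs_nonneg _, Complex.abs_arg_le_pi _⟩
  rcases lt_trichotomy z.order 0 with ho1 | ho1 | ho1
  · -- both coordinates have the same negative order, and cancelling leading terms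
    obtain ⟨o2, l2⟩ : w.order = z.order ∧ w.leadingCoeff = w.coeff z.order := by
      apply order_eq_of_coeff
      · intro h
        have := hcoeff z.order
        rw [h, coeff_one_of_ne ho1.ne, ← c1, add_zero, zero_add] at this
        exact hl1 this
      · intro j hj
        have := hcoeff j
        rwa [lt1 j hj, coeff_one_of_ne (hj.trans ho1).ne, zero_add, zero_add] at this
    have hneg : w.leadingCoeff = -z.leadingCoeff := by
      have := hcoeff z.order
      rw [coeff_one_of_ne ho1.ne, ← c1, ← l2, zero_add] at this
      exact eq_neg_of_add_eq_zero_right this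
    obtain ⟨ε, hε, him⟩ := exists_sign z.leadingCoeff.im
    rw [val₂_eq (X := Pi.single 0 z.order) (by simp; rfl) (by simp; exact o2.symm)]
    change point _ z.leadingCoeff.arg w.leadingCoeff.arg ∈ _
    refine point_mem_tropicalSet (tropData_single (i := 0) (j := 1) (k := 2) (by decide)
      (by decide) ho1.le harg1.1 harg1.2) hε ?_ ?_ ?_ ?_
    · simp
    · rw [sin_sign_abs_arg hε him, sin_sign_mul hε]; simp
    · rw [hneg, Complex.cos_arg (neg_ne_zero.2 hl1)]
      simp [Complex.cos_arg hl1, neg_div]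
    · rw [hneg, Complex.sin_arg]
      have := sin_sign_abs_arg hε him
      rw [sin_sign_mul hε, Complex.sin_arg] at this
      simp [neg_div, this]
  · rcases lt_trichotomy w.order 0 with ho2 | ho2 | ho2
    · exfalso
      have := hcoeff w.order
      rw [coeff_one_of_ne ho2.ne, ← c2, lt1 _ (by rw [ho1]; exact ho2), zero_add, zero_add] at this
      exact hl2 this
    · -- both coordinates have order zero
      have hsum : 1 + z.leadingCoeff + w.leadingCoeff = 0 := by
        have := hcoeff 0
        rwa [coeff_one_zero, ← ho1, ← c1, ho1, ← ho2, ← c2] at this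
      have hpi := pi_le_abs_arg_add_abs_arg hl1 hl2 hsum
      have him : z.leadingCoeff.im + w.leadingCoeff.im = 0 := by
        simpa using congrArg Complex.im hsum
      obtain ⟨ε, hε, hεz⟩ := exists_sign z.leadingCoeff.im
      have hεw : ε * |w.leadingCoeff.im| = -w.leadingCoeff.im := by
        rw [show w.leadingCoeff.im = -z.leadingCoeff.im by linarith, abs_neg, hεz, neg_neg]
      rw [val₂_eq (X := 0) (by simp; exact ho1) (by simp; exact ho2)]
      change point _ z.leadingCoeff.arg w.leadingCoeff.arg ∈ _
      -- The interior angles of the triangle with sides `1` and the two leading coefficients.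
      refine point_mem_tropicalSet (tropData_zero (α := ![|z.leadingCoeff.arg| +
        |w.leadingCoeff.arg| - π, π - |w.leadingCoeff.arg|, π - |z.leadingCoeff.arg|]) ?_ ?_)
        hε ?_ ?_ ?_ ?_
      · intro i
        fin_cases i
        · simpa using hpi
        · simpa using harg2.2
        · simpa using harg1.2
      · simp [Fin.sum_univ_three]
      · simp
      · rw [sin_sign_abs_arg hε hεz, sin_sign_mul hε]; simp
      · simp
      · simp only [Matrix.cons_val_one, Matrix.cons_val_zero, sub_sub_cancel]
        rw [sin_abs_arg, Complex.sin_arg, ← mul_div_assoc, hεw, neg_div, neg_neg]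
    · -- the second coordinate has positive order
      have hz : z.leadingCoeff = -1 := by
        have := hcoeff 0
        rw [coeff_one_zero, lt2 0 ho2, ← ho1, ← c1, add_zero] at this
        exact eq_neg_of_add_eq_zero_right this
      obtain ⟨ε, hε, him⟩ := exists_sign (-w.leadingCoeff.im)
      rw [abs_neg] at him
      rw [val₂_eq (X := Pi.single 2 (-w.order)) (by simp; exact ho1) (by simp; rfl)]
      change point _ z.leadingCoeff.arg w.leadingCoeff.arg ∈ _
      refine point_mem_tropicalSet (tropData_single (i := 2) (j := 0) (k := 1) (by decide)
        (by decide) (by linarith) harg2.1 harg2.2) hε ?_ ?_ ?_ ?_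
      · simp [hz]
      · simp [hz]
      · simp
      · simp [sin_abs_arg, Complex.sin_arg, ← mul_div_assoc, him, neg_div]
  · -- the first coordinate has positive order
    obtain ⟨o2, l2⟩ : w.order = 0 ∧ w.leadingCoeff = w.coeff 0 := by
      apply order_eq_of_coeff
      · intro h
        have := hcoeff 0
        rw [h, coeff_one_zero, lt1 0 ho1, add_zero, add_zero] at this
        exact one_ne_zero this
      · intro j hj
        have := hcoeff j
        rwa [lt1 j (hj.trans ho1), coeff_one_of_ne hj.ne, zero_add, zero_add] at this
    have hw : w.leadingCoeff = -1 := by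
      have := hcoeff 0
      rw [coeff_one_zero, lt1 0 ho1, ← l2, add_zero] at this
      exact eq_neg_of_add_eq_zero_right this
    obtain ⟨ε, hε, him⟩ := exists_sign z.leadingCoeff.im
    rw [val₂_eq (X := Pi.single 1 (-z.order)) (by simp; rfl) (by simp; exact o2)]
    change point _ z.leadingCoeff.arg w.leadingCoeff.arg ∈ _
    refine point_mem_tropicalSet (tropData_single (i := 1) (j := 0) (k := 2) (by decide)
      (by decide) (by linarith) harg1.1 harg1.2) hε ?_ ?_ ?_ ?_
    · simp
    · rw [sin_sign_abs_arg hε him, sin_sign_mul hε]; simp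
    · simp [hw]
    · simp [hw]

/-! ### Realizing tropical points as valuations -/

lemma cos_arg_of_polar {c : ℂ} {ρ a : ℝ} (hρ : 0 < ρ) (hr : c.re = ρ * Real.cos a)
    (hi : c.im = ρ * Real.sin a) :
    c ≠ 0 ∧ Real.cos c.arg = Real.cos a ∧ Real.sin c.arg = Real.sin a := by
  have hn : ‖c‖ = ρ := by
    rw [← sq_eq_sq₀ (norm_nonneg _) hρ.le, Complex.sq_norm, Complex.normSq_apply, hr, hi]
    linear_combination ρ ^ 2 * Real.sin_sq_add_cos_sq a
  have hc : c ≠ 0 := norm_pos_iff.1 (hn ▸ hρ)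
  refine ⟨hc, ?_, ?_⟩
  · rw [Complex.cos_arg hc, hn, hr, mul_div_cancel_left₀ _ hρ.ne']
  · rw [Complex.sin_arg, hn, hi, mul_div_cancel_left₀ _ hρ.ne']

/-- Points of the torus which are valuations of points with given leading terms. -/
lemma point_mem_image {z w : PuiseuxReal} (h : 1 + z + w = 0) {X : Fin 3 → ℝ} {g k a b ρ σ : ℝ}
    (hg : X 1 - X 0 = -g) (hk : X 2 - X 0 = -k) (hz : ∀ j < g, z.coeff j = 0)
    (hw : ∀ j < k, w.coeff j = 0) (hρ : 0 < ρ) (hσ : 0 < σ)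
    (zr : (z.coeff g).re = ρ * Real.cos a) (zi : (z.coeff g).im = ρ * Real.sin a)
    (wr : (w.coeff k).re = σ * Real.cos b) (wi : (w.coeff k).im = σ * Real.sin b) :
    point X a b ∈ val₂ '' puiseuxLine := by
  obtain ⟨z0, zc, zs⟩ := cos_arg_of_polar hρ zr zi
  obtain ⟨w0, wc, ws⟩ := cos_arg_of_polar hσ wr wi
  obtain ⟨oz, lz⟩ := order_eq_of_coeff z0 hz
  obtain ⟨ow, lw⟩ := order_eq_of_coeff w0 hw
  have hz0 : z ≠ 0 := fun h => z0 (by rw [h]; rfl)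
  have hw0 : w ≠ 0 := fun h => w0 (by rw [h]; rfl)
  refine ⟨(Units.mk0 z hz0, Units.mk0 w hw0), h, ?_⟩
  rw [val₂_eq (X := X) (by rw [hg, ← oz]; rfl) (by rw [hk, ← ow]; rfl)]
  simp only [Units.val_mk0, lz, lw]
  exact point_congr X zc zs wc ws

lemma point_mem_image_of_pos {α : Fin 3 → ℝ} (h0 : ∀ i, 0 < α i) (hs : ∑ i, α i = π) {ε : ℝ}
    (hε : ε = 1 ∨ ε = -1) :
    point 0 (ε * (π - α 2)) (-(ε * (π - α 1))) ∈ val₂ '' puiseuxLine := by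
  rw [Fin.sum_univ_three] at hs
  have p0 := h0 0
  have p1 := h0 1
  have p2 := h0 2
  have s0 : 0 < Real.sin (α 0) := Real.sin_pos_of_pos_of_lt_pi p0 (by linarith)
  have s1 : 0 < Real.sin (α 1) := Real.sin_pos_of_pos_of_lt_pi p1 (by linarith)
  have s2 : 0 < Real.sin (α 2) := Real.sin_pos_of_pos_of_lt_pi p2 (by linarith)
  have hadd : Real.sin (α 0)
      = Real.sin (α 1) * Real.cos (α 2) + Real.cos (α 1) * Real.sin (α 2) := by
    rw [← Real.sin_add, ← Real.sin_pi_sub]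
    congr 1
    linarith
  -- Law of sines for the triangle with angles `α` whose side opposite `α 0` has length one.
  set ρ := Real.sin (α 1) / Real.sin (α 0) with hρ
  set σ := Real.sin (α 2) / Real.sin (α 0) with hσ
  let c : ℂ := ⟨ρ * Real.cos (ε * (π - α 2)), ρ * Real.sin (ε * (π - α 2))⟩
  let d : ℂ := ⟨σ * Real.cos (-(ε * (π - α 1))), σ * Real.sin (-(ε * (π - α 1)))⟩
  have hcd : 1 + c + d = 0 := by
    apply Complex.ext
    · simp only [Complex.add_re, Complex.one_re, Complex.zero_re, c, d, Real.cos_neg,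
        cos_sign_mul hε, Real.cos_pi_sub, hρ, hσ]
      field_simp
      linarith
    · simp only [Complex.add_im, Complex.one_im, Complex.zero_im, c, d, Real.sin_neg,
        sin_sign_mul hε, Real.sin_pi_sub, hρ, hσ]
      ring
  refine point_mem_image (z := HahnSeries.single 0 c) (w := HahnSeries.single 0 d) (g := 0) (k := 0)
    (ρ := ρ) (σ := σ) ?_ (by simp) (by simp) ?_ ?_ (div_pos s1 s0) (div_pos s2 s0) ?_ ?_ ?_ ?_
  · rw [← HahnSeries.single_zero_one, ← HahnSeries.single_add, ← HahnSeries.single_add, hcd,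
      HahnSeries.single_eq_zero]
  · exact fun j hj => HahnSeries.coeff_single_of_ne hj.ne
  · exact fun j hj => HahnSeries.coeff_single_of_ne hj.ne
  all_goals simp [c, d]

lemma point_mem_image_of_fst {X α : Fin 3 → ℝ} (hT : TropData X α) (h : X 1 < 0) {ε : ℝ}
    (hε : ε = 1 ∨ ε = -1) :
    point X (ε * (π - α 2)) (-(ε * (π - α 1))) ∈ val₂ '' puiseuxLine := by
  have hX0 : X 0 = 0 := (hT.eq_zero_or 0 1 (by decide)).resolve_right h.ne
  have hX2 : X 2 = 0 := (hT.eq_zero_or 2 1 (by decide)).resolve_right h.ne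
  let c : ℂ := ⟨Real.cos (ε * (π - α 2)), Real.sin (ε * (π - α 2))⟩
  refine point_mem_image (z := HahnSeries.single (-X 1) c) (w := -1 - HahnSeries.single (-X 1) c)
    (g := -X 1) (k := 0) (ρ := 1) (σ := 1) (by ring) (by rw [hX0]; ring) (by rw [hX0, hX2]; ring)
    ?_ ?_ one_pos one_pos ?_ ?_ ?_ ?_
  · exact fun j hj => HahnSeries.coeff_single_of_ne hj.ne
  · intro j hj
    rw [HahnSeries.coeff_sub, HahnSeries.coeff_neg, coeff_one_of_ne hj.ne,
      HahnSeries.coeff_single_of_ne (by linarith)]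
    simp
  · simp [c]
  · simp [c]
  · rw [HahnSeries.coeff_sub, HahnSeries.coeff_neg, coeff_one_zero,
      HahnSeries.coeff_single_of_ne (by linarith), hT.angle_eq_zero 1 h, Real.cos_neg,
      cos_sign_mul hε]
    simp
  · rw [HahnSeries.coeff_sub, HahnSeries.coeff_neg, coeff_one_zero,
      HahnSeries.coeff_single_of_ne (by linarith), hT.angle_eq_zero 1 h, Real.sin_neg,
      sin_sign_mul hε]
    simp

lemma point_mem_image_of_snd {X α : Fin 3 → ℝ} (hT : TropData X α) (h : X 2 < 0) {ε : ℝ}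
    (hε : ε = 1 ∨ ε = -1) :
    point X (ε * (π - α 2)) (-(ε * (π - α 1))) ∈ val₂ '' puiseuxLine := by
  have hX0 : X 0 = 0 := (hT.eq_zero_or 0 2 (by decide)).resolve_right h.ne
  have hX1 : X 1 = 0 := (hT.eq_zero_or 1 2 (by decide)).resolve_right h.ne
  let d : ℂ := ⟨Real.cos (-(ε * (π - α 1))), Real.sin (-(ε * (π - α 1)))⟩
  refine point_mem_image (z := -1 - HahnSeries.single (-X 2) d) (w := HahnSeries.single (-X 2) d)
    (g := 0) (k := -X 2) (ρ := 1) (σ := 1) (by ring) (by rw [hX0, hX1]; ring) (by rw [hX0]; ring)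
    ?_ ?_ one_pos one_pos ?_ ?_ ?_ ?_
  · intro j hj
    rw [HahnSeries.coeff_sub, HahnSeries.coeff_neg, coeff_one_of_ne hj.ne,
      HahnSeries.coeff_single_of_ne (by linarith)]
    simp
  · exact fun j hj => HahnSeries.coeff_single_of_ne hj.ne
  · rw [HahnSeries.coeff_sub, HahnSeries.coeff_neg, coeff_one_zero,
      HahnSeries.coeff_single_of_ne (by linarith), hT.angle_eq_zero 2 h, cos_sign_mul hε]
    simp
  · rw [HahnSeries.coeff_sub, HahnSeries.coeff_neg, coeff_one_zero,
      HahnSeries.coeff_single_of_ne (by linarith), hT.angle_eq_zero 2 h, sin_sign_mul hε]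
    simp
  · simp [d]
  · simp [d]

/-- Here `1` is the negligible term: both series have the negative order `X 0` and opposite leading
coefficients. -/
lemma point_mem_image_of_diag {X α : Fin 3 → ℝ} (hT : TropData X α) (h : X 0 < 0) {ε : ℝ}
    (hε : ε = 1 ∨ ε = -1) :
    point X (ε * (π - α 2)) (-(ε * (π - α 1))) ∈ val₂ '' puiseuxLine := by
  have hX1 : X 1 = 0 := (hT.eq_zero_or 1 0 (by decide)).resolve_right h.ne
  have hX2 : X 2 = 0 := (hT.eq_zero_or 2 0 (by decide)).resolve_right h.ne
  have hα : α 2 = π - α 1 := by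
    have := hT.sum_eq
    rw [Fin.sum_univ_three, hT.angle_eq_zero 0 h] at this
    linarith
  let c : ℂ := ⟨Real.cos (ε * (π - α 2)), Real.sin (ε * (π - α 2))⟩
  refine point_mem_image (z := HahnSeries.single (X 0) c) (w := -1 - HahnSeries.single (X 0) c)
    (g := X 0) (k := X 0) (ρ := 1) (σ := 1) (by ring) (by rw [hX1]; ring) (by rw [hX2]; ring)
    ?_ ?_ one_pos one_pos ?_ ?_ ?_ ?_
  · exact fun j hj => HahnSeries.coeff_single_of_ne hj.ne
  · intro j hj
    rw [HahnSeries.coeff_sub, HahnSeries.coeff_neg, coeff_one_of_ne (by linarith),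
      HahnSeries.coeff_single_of_ne hj.ne]
    simp
  · simp [c]
  · simp [c]
  · rw [HahnSeries.coeff_sub, HahnSeries.coeff_neg, coeff_one_of_ne h.ne,
      HahnSeries.coeff_single_same, Real.cos_neg, cos_sign_mul hε]
    simp [c, cos_sign_mul hε, hα]
  · rw [HahnSeries.coeff_sub, HahnSeries.coeff_neg, coeff_one_of_ne h.ne,
      HahnSeries.coeff_single_same, Real.sin_neg, sin_sign_mul hε]
    simp [c, sin_sign_mul hε, hα]

/-- Points with some zero angle are limits of points with positive angles, taken on the segment to
the barycentre `(π/3, π/3, π/3)`. -/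
lemma point_zero_mem_closure {α : Fin 3 → ℝ} (h0 : ∀ i, 0 ≤ α i) (hs : ∑ i, α i = π) {ε : ℝ}
    (hε : ε = 1 ∨ ε = -1) :
    point 0 (ε * (π - α 2)) (-(ε * (π - α 1))) ∈ phaseTropicalLine := by
  let β : ℝ → Fin 3 → ℝ := fun s i => (1 - s) * α i + s * (π / 3)
  have hβ : ∀ i, Continuous fun s => β s i := fun i => by fun_prop
  have hc : Continuous fun s => point 0 (ε * (π - β s 2)) (-(ε * (π - β s 1))) :=
    continuous_point continuous_const (continuous_const.mul (continuous_const.sub (hβ 2)))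
      (continuous_const.mul (continuous_const.sub (hβ 1))).neg
  have h := (hc.tendsto 0).mono_left (nhdsWithin_le_nhds (s := Set.Ioi (0 : ℝ)))
  have e : β 0 = α := by ext i; simp [β]
  rw [e] at h
  refine mem_closure_of_tendsto h ?_
  filter_upwards [Ioo_mem_nhdsGT (zero_lt_one' ℝ)] with s hs'
  refine point_mem_image_of_pos (fun i => ?_) ?_ hε
  · have h1 := mul_nonneg (sub_nonneg.2 hs'.2.le) (h0 i)
    have h2 := mul_pos hs'.1 (div_pos Real.pi_pos three_pos)
    simp only [β]
    linarith
  · simp only [β]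
    rw [Finset.sum_add_distrib, ← Finset.mul_sum, hs]
    simp
    ring

/-- The phase tropical line in terms of lengths and angles. -/
lemma phaseTropicalLine_eq : phaseTropicalLine = tropicalSet := by
  apply Set.Subset.antisymm
  · refine closure_minimal ?_ isClosed_tropicalSet
    rintro _ ⟨p, hp, rfl⟩
    exact val₂_mem_tropicalSet hp
  · rintro _ ⟨X, α, hT, ε, hε, rfl⟩
    by_cases hX : ∃ i, X i < 0
    · refine subset_closure ?_
      obtain ⟨i, hi⟩ := hX
      fin_cases i
      · exact point_mem_image_of_diag hT hi hε
      · exact point_mem_image_of_fst hT hi hε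
      · exact point_mem_image_of_snd hT hi hε
    · push Not at hX
      have : X = 0 := funext fun i => le_antisymm (hT.nonpos i) (hX i)
      subst this
      exact point_zero_mem_closure hT.nonneg hT.sum_eq hε

end PhaseTropical

end

theorem theorem1p1 :
    ∃ Ψ : PhaseTropical.complexLine × unitInterval → PhaseTropical.Torus,
      Continuous Ψ ∧
      (∀ P : PhaseTropical.complexLine, Ψ (P, 0) = (P : PhaseTropical.Torus)) ∧
      Set.range (fun P : PhaseTropical.complexLine => Ψ (P, 1)) =
        PhaseTropical.phaseTropicalLine ∧
      ∀ t : unitInterval,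
        Topology.IsEmbedding (fun P : PhaseTropical.complexLine => Ψ (P, t)) :=
  ⟨fun p => PhaseTropical.isotopy p.2 p.1, PhaseTropical.continuous_isotopy,
    fun P => PhaseTropical.isotopy_zero P.2,
    PhaseTropical.range_isotopy_one.trans PhaseTropical.phaseTropicalLine_eq.symm,
    fun t => (PhaseTropical.isClosedEmbedding_isotopy t.2).isEmbedding⟩
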